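/- Let $K$ be a field that is complete with respect to a non-trivial non-Archimedean absolute value $|\cdot|$, let $R=\{x\in K:|x|\le 1\}$ be its ring of integers, $k$ its residue field, and let $\pi\in R$ be any element with $0<|\pi|<1$ (for instance $\pi=p$ if $K$ has characteristic $0$ and $k$ has characteristic $p>0$). Let $N$ be a free abelian group of finite rank, $M=\mathrm{Hom}(N,\mathbb Z)$, let $\sigma\subseteq N_{\mathbb R}=N\otimes_{\mathbb Z}\mathbb R$ be a strongly convex rational polyhedral cone (a cone generated by finitely many vectors of $N$ that contains no line through the origin), and let $S_\sigma=\{u\in M:\langle u,v\rangle\ge 0\text{ for all }v\in\sigma\}$. Define $$K\langle S_\sigma\rangle = K\otimes_R\varprojlim_n\,(R/\pi^nR)[S_\sigma],$$ and write $\chi^u$ for the monomial of $u\in S_\sigma$. For $f\in A=K\langle S_\sigma\rangle$ let $|f|_{\sup}=\sup_{x\in\mathrm{Max}\,A}|f(x)|$, where $f(x)$ is the image of $f$ in the residue field $A/x$ and $|\cdot|$ on $A/x$ is the unique extension of the absolute value of $K$. Then $|\cdot|_{\sup}$ is a non-Archimedean $K$-algebra seminorm on $A$, and the reduction $$\widetilde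 A=\{f\in A:|f|_{\sup}\le 1\}/\{f\in A:|f|_{\sup}<1\}$$ is isomorphic, as a $k$-algebra, to the semigroup algebra $k[S_\sigma]$, by an isomorphism that sends the class of $\chi^u$ to the monomial $u$ for every $u\in S_\sigma$. -/

import Mathlib

open scoped TensorProduct ENNReal

noncomputable section

namespace ToricAffinoid

/-! ### Cones and their semigroups -/

section Cones

variable (N : Type*) [AddCommGroup N]

/-- The real vector space `N_ℝ = ℝ ⊗ N` of a lattice `N`. -/
abbrev RealSpace : Type _ := ℝ ⊗[ℤ] N

variable {N}

/-- A cone in `N_ℝ` is rational polyhedral if it is generated by finitely many vectors of the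
lattice `N`. -/
def IsRationalPolyhedral (σ : PointedCone ℝ (RealSpace N)) : Prop :=
  ∃ s : Finset N, σ = PointedCone.hull ℝ ((fun v : N => (1 : ℝ) ⊗ₜ[ℤ] v) '' (s : Set N))

/-- A cone is strongly convex if it contains no line through the origin. -/
def IsStronglyConvex (σ : PointedCone ℝ (RealSpace N)) : Prop :=
  ∀ x ∈ σ, -x ∈ σ → x = 0

/-- The dual cone `σ^∨ = {u ∈ V* : ⟨u, v⟩ ≥ 0 for all v ∈ σ}` of a cone in `V = N_ℝ`. -/
def dualCone (σ : PointedCone ℝ (RealSpace N)) :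
    PointedCone ℝ (Module.Dual ℝ (RealSpace N)) :=
  PointedCone.dual (Module.Dual.eval ℝ (RealSpace N)) (σ : Set (RealSpace N))

/-- The semigroup `S_σ = σ^∨ ∩ M`, where the dual lattice `M = Hom(N, ℤ)` is mapped to the dual
space of `N_ℝ` by extension of scalars. -/
def dualSemigroup (σ : PointedCone ℝ (RealSpace N)) : AddSubmonoid (Module.Dual ℤ N) where
  carrier := {u | Module.Dual.baseChange ℝ u ∈ dualCone σ}
  zero_mem' := by simp
  add_mem' {u v} hu hv := by
    simp only [Set.mem_ofPred_eq, map_add] at *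
    exact add_mem hu hv

end Cones

/-! ### Toric affinoid algebras -/

section Algebras

variable (K : Type*) [NontriviallyNormedField K] [IsUltrametricDist K]

/-- The ring of integers `R = {x ∈ K : |x| ≤ 1}`. -/
abbrev Integers : ValuationSubring K :=
  (NormedField.valuation (K := K)).valuationSubring

/-- The residue field `k` of `K`. -/
abbrev ResidueField : Type _ := IsLocalRing.ResidueField (Integers K)

variable {K}

/-- The inverse limit of the semigroup algebras `(R / π ^ n)[S] = R[S] / π ^ n R[S]`. -/
def IntegralAlgebra (π : Integers K) (S : Type*) [AddCommMonoid S] : Type _ :=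
  AdicCompletion
    (Ideal.span {algebraMap (Integers K) (AddMonoidAlgebra (Integers K) S) π})
    (AddMonoidAlgebra (Integers K) S)

instance (π : Integers K) (S : Type*) [AddCommMonoid S] : CommRing (IntegralAlgebra π S) :=
  inferInstanceAs (CommRing (AdicCompletion _ (AddMonoidAlgebra (Integers K) S)))

instance (π : Integers K) (S : Type*) [AddCommMonoid S] :
    Algebra (AddMonoidAlgebra (Integers K) S) (IntegralAlgebra π S) :=
  inferInstanceAs (Algebra _ (AdicCompletion _ (AddMonoidAlgebra (Integers K) S)))

instance (π : Integers K) (S : Type*) [AddCommMonoid S] :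
    Algebra (Integers K) (IntegralAlgebra π S) :=
  inferInstanceAs (Algebra _ (AdicCompletion _ (AddMonoidAlgebra (Integers K) S)))

/-- The algebra `K⟨S⟩ = K ⊗_R lim (R / π ^ n)[S]`. -/
def ToricAlgebra (π : Integers K) (S : Type*) [AddCommMonoid S] : Type _ :=
  K ⊗[Integers K] IntegralAlgebra π S

instance (π : Integers K) (S : Type*) [AddCommMonoid S] : CommRing (ToricAlgebra π S) :=
  inferInstanceAs (CommRing (K ⊗[Integers K] IntegralAlgebra π S))

instance (π : Integers K) (S : Type*) [AddCommMonoid S] : Algebra K (ToricAlgebra π S) :=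
  inferInstanceAs (Algebra K (K ⊗[Integers K] IntegralAlgebra π S))

/-- The monomial `χ ^ u` of `K⟨S⟩`. -/
def monomial (π : Integers K) {S : Type*} [AddCommMonoid S] (u : S) : ToricAlgebra π S :=
  (1 : K) ⊗ₜ[Integers K]
    algebraMap (AddMonoidAlgebra (Integers K) S) (IntegralAlgebra π S)
      (AddMonoidAlgebra.single u (1 : Integers K))

end Algebras

/-! ### The supremum norm -/

section SupNorm

variable (K : Type*) [NontriviallyNormedField K] {A : Type*} [CommRing A] [Algebra K A]

/-- The value `|f(x)|` at a point `x ∈ Max A`: the image of `f` in the residue field `A / x` (a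
finite extension of `K` when `A` is affinoid), measured by the unique absolute value that extends
the one of the complete field `K`. -/
def valueAt (x : MaximalSpectrum A) (f : A) : ℝ :=
  letI : Field (A ⧸ x.asIdeal) := Ideal.Quotient.field x.asIdeal
  spectralNorm K (A ⧸ x.asIdeal) (Ideal.Quotient.mk x.asIdeal f)

/-- The supremum (semi-)norm `|f|_sup`, the supremum of `|f(x)|` over `x ∈ Max A`. It is taken in
`[0, ∞]`, so that no boundedness is presupposed. -/
def supNorm (f : A) : ℝ≥0∞ :=
  ⨆ x : MaximalSpectrum A, ENNReal.ofReal (valueAt K x f)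

/-- The supremum norm of `A` is a non-Archimedean `K`-algebra seminorm. -/
structure IsSupSeminorm (K : Type*) [NontriviallyNormedField K] (A : Type*) [CommRing A]
    [Algebra K A] : Prop where
  add_le_max : ∀ f g : A, supNorm K (f + g) ≤ max (supNorm K f) (supNorm K g)
  mul_le : ∀ f g : A, supNorm K (f * g) ≤ supNorm K f * supNorm K g
  algebraMap_le : ∀ c : K, supNorm K (algebraMap K A c) ≤ ENNReal.ofReal ‖c‖

end SupNorm

/-! ### The reduction -/

section Reduction

variable {K : Type*} [NontriviallyNormedField K] {A : Type*} [CommRing A] [Algebra K A]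

theorem IsSupSeminorm.neg_le (h : IsSupSeminorm K A) (f : A) : supNorm K (-f) ≤ supNorm K f := by
  have h1 : supNorm K (algebraMap K A (-1)) ≤ 1 := by
    simpa using h.algebraMap_le (-1)
  calc supNorm K (-f) = supNorm K (algebraMap K A (-1) * f) := by simp
    _ ≤ supNorm K (algebraMap K A (-1)) * supNorm K f := h.mul_le _ _
    _ ≤ 1 * supNorm K f := by gcongr
    _ = supNorm K f := one_mul _

/-- The ring `{f ∈ A : |f|_sup ≤ 1}`. -/
def unitBall (h : IsSupSeminorm K A) : Subring A where
  carrier := {f | supNorm K f ≤ 1}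
  mul_mem' {f g} hf hg := (h.mul_le f g).trans (mul_le_one' hf hg)
  one_mem' := by simpa using h.algebraMap_le 1
  add_mem' {f g} hf hg := (h.add_le_max f g).trans (max_le hf hg)
  zero_mem' := by
    have := h.algebraMap_le 0
    simp only [map_zero, norm_zero, ENNReal.ofReal_zero] at this
    exact this.trans zero_le_one
  neg_mem' {f} hf := (h.neg_le f).trans hf

/-- The ideal `{f ∈ A : |f|_sup < 1}` of `{f ∈ A : |f|_sup ≤ 1}`. -/
def openUnitBall (h : IsSupSeminorm K A) : Ideal (unitBall h) where
  carrier := {f | supNorm K (f : A) < 1}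
  add_mem' {f g} hf hg := (h.add_le_max f g).trans_lt (max_lt hf hg)
  zero_mem' := by
    have := h.algebraMap_le 0
    simp only [map_zero, norm_zero, ENNReal.ofReal_zero] at this
    exact this.trans_lt zero_lt_one
  smul_mem' f g hg := by
    have hf : supNorm K (f : A) ≤ 1 := f.2
    have hg' : supNorm K (g : A) < 1 := hg
    calc supNorm K ((f : A) * (g : A)) ≤ supNorm K (f : A) * supNorm K (g : A) := h.mul_le _ _
      _ ≤ 1 * supNorm K (g : A) := by gcongr
      _ < 1 := by simpa using hg'

/-- The reduction `{f ∈ A : |f|_sup ≤ 1} / {f ∈ A : |f|_sup < 1}` of `A`. -/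
def Reduction (h : IsSupSeminorm K A) : Type _ := unitBall h ⧸ openUnitBall h

instance (h : IsSupSeminorm K A) : CommRing (Reduction h) :=
  inferInstanceAs (CommRing (unitBall h ⧸ openUnitBall h))

/-- The class in the reduction of an element of supremum norm at most `1`. -/
def Reduction.mk (h : IsSupSeminorm K A) : unitBall h →+* Reduction h :=
  Ideal.Quotient.mk (openUnitBall h)

variable [IsUltrametricDist K]

/-- The map `R → {f ∈ A : |f|_sup ≤ 1}` given by the `K`-algebra structure of `A`. -/
def integersToUnitBall (h : IsSupSeminorm K A) : Integers K →+* unitBall h :=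
  ((algebraMap K A).comp (Integers K).subtype).codRestrict (unitBall h) fun c =>
    (h.algebraMap_le c).trans (by
      have : ‖(c : K)‖ ≤ 1 := c.2
      exact ENNReal.ofReal_le_one.mpr this)

/-- The reduction is an algebra over the residue field `k`: the class of `c ∈ R` acts as the class
of `c` in the reduction. -/
instance (h : IsSupSeminorm K A) : Algebra (ResidueField K) (Reduction h) :=
  RingHom.toAlgebra <|
    Ideal.Quotient.lift (IsLocalRing.maximalIdeal (Integers K))
      ((Reduction.mk h).comp (integersToUnitBall h)) fun c hc => by
        refine Ideal.Quotient.eq_zero_iff_mem.mpr ((h.algebraMap_le (c : K)).trans_lt ?_)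
        have : ‖(c : K)‖ < 1 :=
          (Valuation.mem_maximalIdeal_iff _ _).mp hc
        exact ENNReal.ofReal_lt_one.mpr this

end Reduction

end ToricAffinoid

end

/-! Let `B` be the `π`-adic completion of `R[S]`, so that `A = K ⊗ B`. The point is that the
supremum norm is the Gauss norm. This rests on three facts: `|b| ≤ 1` for `b ∈ B`; `|P| ≥ 1` for `P
∈ R[S]` with nonzero image in `k[S]`; and every nonzero `b ∈ B` is a scalar times some `P + c' b'`
with such a `P` and `c' ∈ 𝔪` (`exists_eq_mul_of_ne_zero`). Hence `R[S]` maps onto the reduction of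
`A`, with the same kernel as `R[S] → k[S]`.

Upper bound: let `B'` be the image of `B` in a residue field `A / x`. Then `B'[1/π]` is a field, and
`B' / 𝔪B'` is nonzero and of finite type over `k`. Noether normalization of this quotient and a
determinant argument (`noether_dimension_eq_zero`) show that it has dimension zero, and completeness
of `R` makes `B'` finite over `R`. So `A / x` is algebraic over `K`, which gives the seminorm
axioms, and elements of `B` are integral at `x`, hence of value at most 1.

Lower bound: `k[S]` is a domain, so the reduction of `P` is not nilpotent. Invert in `B` all
elements whose reduction is a power of that of `P`. The result need not be complete, but `𝔪` still
lies in its Jacobson radical and it is still of finite type modulo `π`, which is all that the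
finiteness argument uses. Its generic fibre is nonzero, and a maximal ideal there contracts to a
point `x` of `A` where `1/P` is integral, so `|P(x)| ≥ 1`. -/

namespace ToricReduction

/-! ### Contents and ideals over a valuation ring -/

section Content

open IsLocalRing

variable {R : Type*} [CommRing R] [IsDomain R] [ValuationRing R]

/-- A finite subset of a valuation ring with a nonzero element has a nonzero element that
divides all the others. -/
theorem exists_mem_forall_dvd {ι : Type*} (s : Finset ι) (hs : s.Nonempty) (f : ι → R) :
    ∃ i ∈ s, ∀ j ∈ s, f i ∣ f j := by
  classical
  induction hs using Finset.Nonempty.cons_induction with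
  | singleton a => exact ⟨a, by simp, by simp⟩
  | cons a s ha hs ih =>
    obtain ⟨i, hi, hd⟩ := ih
    rcases ValuationRing.dvd_total (f a) (f i) with h | h
    · exact ⟨a, by simp, by
        intro j hj
        rcases Finset.mem_cons.mp hj with rfl | hj
        · exact dvd_rfl
        · exact h.trans (hd j hj)⟩
    · exact ⟨i, by simp [hi], by
        intro j hj
        rcases Finset.mem_cons.mp hj with rfl | hj
        · exact h
        · exact hd j hj⟩

/-- A nonzero element of a semigroup algebra over a valuation ring is a multiple of one with
nonzero reduction. -/
theorem exists_smul_map_residue_ne_zero {S : Type*} (F : AddMonoidAlgebra R S) (hF : F ≠ 0) :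
    ∃ (c : R) (G : AddMonoidAlgebra R S), c ≠ 0 ∧ F = c • G ∧
      AddMonoidAlgebra.map (residue R : R →+ ResidueField R) G ≠ 0 := by
  have hF' : F.coeff ≠ 0 := fun h => hF (by ext; simp [h])
  obtain ⟨i, hi, hd⟩ := exists_mem_forall_dvd F.coeff.support
    (Finsupp.support_nonempty_iff.mpr hF') F.coeff
  have hi0 : F.coeff i ≠ 0 := Finsupp.mem_support_iff.mp hi
  have hd' : ∀ j, F.coeff i ∣ F.coeff j := fun j => by
    by_cases hj : F.coeff j = 0
    · simp [hj]
    · exact hd j (Finsupp.mem_support_iff.mpr hj)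
  choose g hg using hd'
  let G : S →₀ R := Finsupp.onFinset F.coeff.support g fun j hj => by
    rw [Finsupp.mem_support_iff, hg j]
    exact mul_ne_zero hi0 hj
  refine ⟨F.coeff i, .ofCoeff G, hi0, ?_, fun h => ?_⟩
  · ext j
    simpa [G] using hg j
  · have h1 : residue R (g i) = 0 := by
      simpa [G] using congrArg (fun x => x.coeff i) h
    have h2 : g i = 1 := mul_left_cancel₀ hi0 (by rw [← hg i, mul_one])
    simp [h2] at h1

variable {B : Type*} [CommRing B] [Algebra R B]

/-- Divisibility in `R` is total, so a sum of a multiple of `c` and a multiple of `c'` is a multiple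
of whichever of the two divides the other. -/
theorem mem_map_maximalIdeal_iff (z : B) :
    z ∈ (maximalIdeal R).map (algebraMap R B) ↔
      ∃ c ∈ maximalIdeal R, ∃ b : B, z = algebraMap R B c * b := by
  constructor
  · intro hz
    induction hz using Submodule.span_induction with
    | mem x hx =>
      obtain ⟨c, hc, rfl⟩ := hx
      exact ⟨c, hc, 1, by simp⟩
    | zero => exact ⟨0, zero_mem _, 0, by simp⟩
    | add x y _ _ hx hy =>
      obtain ⟨c, hc, b, rfl⟩ := hx
      obtain ⟨c', hc', b', rfl⟩ := hy
      rcases ValuationRing.dvd_total c c' with ⟨d, rfl⟩ | ⟨d, rfl⟩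
      · exact ⟨c, hc, b + algebraMap R B d * b', by rw [map_mul]; ring⟩
      · exact ⟨c', hc', b' + algebraMap R B d * b, by rw [map_mul]; ring⟩
    | smul a x _ hx =>
      obtain ⟨c, hc, b, rfl⟩ := hx
      exact ⟨c, hc, a * b, by rw [smul_eq_mul]; ring⟩
  · rintro ⟨c, hc, b, rfl⟩
    exact Ideal.mul_mem_right _ _ (Ideal.mem_map_of_mem _ hc)

/-- Finitely many elements of `𝔪 B` lie in `c B` for some `c ∈ 𝔪`. -/
theorem exists_common_divisor (s : Finset B)
    (hs : ∀ z ∈ s, z ∈ (maximalIdeal R).map (algebraMap R B)) {π : R} (hπ : π ∈ maximalIdeal R) :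
    ∃ c ∈ maximalIdeal R, c ∣ π ∧ ∀ z ∈ s, algebraMap R B c ∣ z := by
  classical
  induction s using Finset.induction_on with
  | empty => exact ⟨π, hπ, dvd_rfl, by simp⟩
  | insert a s ha ih =>
    obtain ⟨c, hc, hcπ, h⟩ := ih fun z hz => hs z (by simp [hz])
    obtain ⟨c', hc', b, hb⟩ := (mem_map_maximalIdeal_iff a).mp (hs a (by simp))
    rcases ValuationRing.dvd_total c c' with hd | hd
    · refine ⟨c, hc, hcπ, fun z hz => ?_⟩
      rcases Finset.mem_insert.mp hz with rfl | hz
      · exact ((algebraMap R B).map_dvd hd).trans ⟨b, hb⟩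
      · exact h z hz
    · refine ⟨c', hc', hd.trans hcπ, fun z hz => ?_⟩
      rcases Finset.mem_insert.mp hz with rfl | hz
      · exact ⟨b, hb⟩
      · exact ((algebraMap R B).map_dvd hd).trans (h z hz)

omit [IsDomain R] [ValuationRing R] in
/-- Successive approximation. -/
theorem approx_pow {Q : Submodule R B} {c : R} (h : ∀ b : B, ∃ q ∈ Q, algebraMap R B c ∣ b - q)
    (n : ℕ) (b : B) : ∃ q ∈ Q, algebraMap R B (c ^ n) ∣ b - q := by
  induction n with
  | zero => exact ⟨0, zero_mem _, by simp⟩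
  | succ n ih =>
    obtain ⟨q, hq, b', hb'⟩ := ih
    obtain ⟨q', hq', b'', hb''⟩ := h b'
    refine ⟨q + c ^ n • q', add_mem hq (Q.smul_mem _ hq'), b'', ?_⟩
    rw [Algebra.smul_def, ← sub_sub, hb', pow_succ, map_mul, mul_assoc, ← hb'']
    ring

end Content

/-! ### Noether normalization modulo `𝔪`, lifted `π`-adically -/

section Noether

open IsLocalRing

variable {R : Type*} [CommRing R] [IsDomain R] [ValuationRing R] {B : Type*} [CommRing B]
  [Algebra R B]

/-- If `B = R[X] + π B` for a finite set `X` and `B / 𝔪 B ≠ 0`, then there are finitely many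
`y_i ∈ B`, algebraically independent over the residue field in `B / 𝔪 B`, such that `B` is
`π`-adically approximated by a finite module over `R[y]`. -/
theorem exists_noether_normalization {π : R} (hπ : π ∈ maximalIdeal R)
    (hrad : ∀ c ∈ maximalIdeal R, ∃ n, π ∣ c ^ n) (X : Finset B)
    (hX : ∀ b : B, ∃ p ∈ Algebra.adjoin R (X : Set B), algebraMap R B π ∣ b - p)
    (htop : (maximalIdeal R).map (algebraMap R B) ≠ ⊤) :
    ∃ (d : ℕ) (y : Fin d → B),
      (∀ F : MvPolynomial (Fin d) R,
        MvPolynomial.aeval y F ∈ (maximalIdeal R).map (algebraMap R B) →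
          MvPolynomial.map (residue R) F = 0) ∧
      ∃ (r : ℕ) (e : Fin r → B), ∀ (n : ℕ) (b : B), ∃ p : Fin r → MvPolynomial (Fin d) R,
        algebraMap R B (π ^ n) ∣ b - ∑ i, MvPolynomial.aeval y (p i) * e i := by
  classical
  set J := (maximalIdeal R).map (algebraMap R B) with hJ
  let C := B ⧸ J
  have : Nontrivial C := Ideal.Quotient.nontrivial_iff.mpr htop
  let : Algebra (ResidueField R) C := RingHom.toAlgebra <|
    Ideal.Quotient.lift (maximalIdeal R) ((Ideal.Quotient.mk J).comp (algebraMap R B))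
      fun c hc => Ideal.Quotient.eq_zero_iff_mem.mpr (Ideal.mem_map_of_mem _ hc)
  have : IsScalarTower R (ResidueField R) C := .of_algebraMap_eq fun _ => rfl
  have hπJ : ∀ b : B, algebraMap R B π ∣ b → b ∈ J := fun b hb =>
    (mem_map_maximalIdeal_iff b).mpr ⟨π, hπ, hb⟩
  have : Algebra.FiniteType R C := by
    refine ⟨⟨X.image (Ideal.Quotient.mkₐ R J), ?_⟩⟩
    rw [Finset.coe_image, Algebra.adjoin_image, eq_top_iff]
    rintro z -
    obtain ⟨b, rfl⟩ := Ideal.Quotient.mk_surjective z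
    obtain ⟨p, hp, hd⟩ := hX b
    exact ⟨p, hp, (Ideal.Quotient.eq.mpr (hπJ _ hd)).symm⟩
  have : Algebra.FiniteType (ResidueField R) C :=
    Algebra.FiniteType.of_restrictScalars_finiteType R _ _
  obtain ⟨d, g, ginj, gfin⟩ := exists_finite_inj_algHom_of_fg (ResidueField R) C
  choose y hy using fun i => Ideal.Quotient.mk_surjective (g (MvPolynomial.X i))
  have key : ∀ F : MvPolynomial (Fin d) R, Ideal.Quotient.mk J (MvPolynomial.aeval y F) =
      g (MvPolynomial.map (residue R) F) := by
    have : (Ideal.Quotient.mk J).comp (MvPolynomial.aeval y : _ →ₐ[R] B).toRingHom =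
        g.toRingHom.comp (MvPolynomial.map (residue R)) := by
      apply MvPolynomial.ringHom_ext
      · intro r
        simp only [AlgHom.toRingHom_eq_coe, RingHom.comp_apply, RingHom.coe_coe,
          MvPolynomial.map_C]
        rw [← MvPolynomial.algebraMap_eq, ← MvPolynomial.algebraMap_eq, AlgHom.commutes,
          AlgHom.commutes]
        rfl
      · intro i
        simp [hy]
    exact fun F => RingHom.congr_fun this F
  refine ⟨d, y, fun F hF => ?_, ?_⟩
  · apply ginj
    rw [← key, map_zero]
    exact Ideal.Quotient.eq_zero_iff_mem.mpr hF
  let : Algebra (MvPolynomial (Fin d) (ResidueField R)) C := g.toRingHom.toAlgebra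
  have : Module.Finite (MvPolynomial (Fin d) (ResidueField R)) C := gfin
  obtain ⟨r, ē, hē⟩ := Module.Finite.exists_fin
    (R := MvPolynomial (Fin d) (ResidueField R)) (M := C)
  choose e he using fun i => Ideal.Quotient.mk_surjective (ē i)
  refine ⟨r, e, ?_⟩
  let D := (MvPolynomial.aeval y : MvPolynomial (Fin d) R →ₐ[R] B).range
  let Q : Submodule D B := Submodule.span D (Set.range e)
  have hQ : ∀ b : B, ∃ q ∈ Q, b - q ∈ J := by
    intro b
    have hb : (Ideal.Quotient.mk J b : C) ∈ Submodule.span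
      (MvPolynomial (Fin d) (ResidueField R)) (Set.range ē) := hē ▸ Submodule.mem_top
    obtain ⟨p, hp⟩ := (Submodule.mem_span_range_iff_exists_fun _).mp hb
    choose p' hp' using fun i => MvPolynomial.map_surjective (residue R) residue_surjective (p i)
    refine ⟨∑ i, MvPolynomial.aeval y (p' i) * e i, Submodule.sum_mem _ fun i _ => ?_, ?_⟩
    · exact Q.smul_mem (⟨_, p' i, rfl⟩ : D) (Submodule.subset_span ⟨i, rfl⟩)
    · rw [← Ideal.Quotient.eq, ← hp, map_sum]
      refine Finset.sum_congr rfl fun i _ => ?_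
      rw [map_mul, key, hp', he]
      rfl
  obtain ⟨q₁, hq₁, h₁⟩ := hQ 1
  choose q hq hqJ using fun z : B × Fin r => hQ (z.1 * e z.2)
  -- `𝔪` need not be finitely generated, so congruences modulo `𝔪B` cannot be iterated directly. The
  -- finitely many that matter, for `1` and the products `x * e i`, hold modulo one `c ∈ 𝔪`.
  obtain ⟨c, hc, hcπ, hcd⟩ := exists_common_divisor
    (insert (1 - q₁) ((X ×ˢ Finset.univ).image fun z : B × Fin r => z.1 * e z.2 - q z))
    (by
      intro z hz
      rcases Finset.mem_insert.mp hz with rfl | hz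
      · exact h₁
      · obtain ⟨w, -, rfl⟩ := Finset.mem_image.mp hz
        exact hqJ w) hπ
  have hQc : ∀ b : B, ∃ q ∈ Q, algebraMap R B c ∣ b - q := by
    -- `Q + cB` contains `1` and is stable under `R[X]`. As `c ∣ π`, it is all of `B`.
    let Q' : Submodule D B :=
      Q ⊔ (Ideal.span {algebraMap R B c} : Ideal B).restrictScalars D
    have hcQ : ∀ b, algebraMap R B c ∣ b → b ∈ Q' := fun b hb =>
      Submodule.mem_sup_right (Ideal.mem_span_singleton.mpr hb)
    have hXQ : ∀ a ∈ Algebra.adjoin R (X : Set B), ∀ q ∈ Q', a * q ∈ Q' := by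
      intro a ha
      induction ha using Algebra.adjoin_induction with
      | mem x hx =>
        intro q' hq'
        obtain ⟨z, hz, w, hw, rfl⟩ := Submodule.mem_sup.mp hq'
        rw [mul_add]
        refine add_mem ?_ (hcQ _ (dvd_mul_of_dvd_right (Ideal.mem_span_singleton.mp hw) _))
        clear hq'
        induction hz using Submodule.span_induction with
        | mem z hz =>
          obtain ⟨i, rfl⟩ := hz
          have h2 := hcd (x * e i - q (x, i)) (Finset.mem_insert_of_mem
            (Finset.mem_image.mpr ⟨(x, i), by simpa using hx, rfl⟩))
          rw [← sub_add_cancel (x * e i) (q (x, i))]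
          exact add_mem (hcQ _ h2) (Submodule.mem_sup_left (hq _))
        | zero => simp
        | add u v _ _ hu hv =>
          rw [mul_add]
          exact add_mem hu hv
        | smul a u _ hu =>
          rw [mul_smul_comm]
          exact Q'.smul_mem _ hu
      | algebraMap a =>
        intro q hq
        rw [← Algebra.smul_def]
        exact Q'.smul_of_tower_mem a hq
      | add a b _ _ ha hb =>
        intro q hq
        rw [add_mul]
        exact add_mem (ha q hq) (hb q hq)
      | mul a b _ _ ha hb =>
        intro q hq
        rw [mul_assoc]
        exact ha _ (hb q hq)
    have h1 : (1 : B) ∈ Q' := by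
      rw [← sub_add_cancel 1 q₁]
      exact add_mem (hcQ _ (hcd _ (Finset.mem_insert_self _ _))) (Submodule.mem_sup_left hq₁)
    intro b
    obtain ⟨p, hp, hd⟩ := hX b
    have hb : b ∈ Q' := by
      rw [← sub_add_cancel b p]
      refine add_mem (hcQ _ (((algebraMap R B).map_dvd hcπ).trans hd)) ?_
      simpa using hXQ p hp 1 h1
    obtain ⟨z, hz, w, hw, rfl⟩ := Submodule.mem_sup.mp hb
    exact ⟨z, hz, by simpa using Ideal.mem_span_singleton.mp hw⟩
  intro n b
  -- `π ∣ c ^ N`, so approximation modulo `c ^ (N * n)` gives approximation modulo `π ^ n`.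
  obtain ⟨N, hN⟩ := hrad c hc
  obtain ⟨z, hz, hzd⟩ := approx_pow (Q := Q.restrictScalars R) hQc (N * n) b
  obtain ⟨a, rfl⟩ := (Submodule.mem_span_range_iff_exists_fun _).mp hz
  choose p hp using fun i => (a i).2
  refine ⟨p, (((algebraMap R B).map_dvd ?_).trans hzd).trans (dvd_of_eq ?_)⟩
  · rw [pow_mul]
    exact pow_dvd_pow_of_dvd hN n
  · congr 1
    refine Finset.sum_congr rfl fun i _ => ?_
    rw [Subalgebra.smul_def, smul_eq_mul, ← hp i]
    rfl

end Noether

/-! ### Dimension zero and finiteness over `R` -/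

section Finiteness

open IsLocalRing

variable {R : Type*} [CommRing R] [IsDomain R] [ValuationRing R] {B : Type*} [CommRing B]
  [IsDomain B] [Algebra R B]

/-- If every nonzero element of `B` divides a power of `π`, then the elements `y_i` of a Noether
normalization of `B / 𝔪 B` do not exist. -/
theorem noether_dimension_eq_zero {π : R} (hπ0 : π ≠ 0) (hπ : π ∈ maximalIdeal R)
    (hinj : Function.Injective (algebraMap R B))
    (hinv : ∀ b : B, b ≠ 0 → ∃ n : ℕ, b ∣ algebraMap R B (π ^ n))
    {d : ℕ} (y : Fin d → B)
    (hy : ∀ F : MvPolynomial (Fin d) R,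
        MvPolynomial.aeval y F ∈ (maximalIdeal R).map (algebraMap R B) →
          MvPolynomial.map (residue R) F = 0)
    {r : ℕ} (e : Fin r → B) (he : ∀ (n : ℕ) (b : B), ∃ p : Fin r → MvPolynomial (Fin d) R,
        algebraMap R B (π ^ n) ∣ b - ∑ i, MvPolynomial.aeval y (p i) * e i) : d = 0 := by
  classical
  by_contra hd
  let i₀ : Fin d := ⟨0, Nat.pos_of_ne_zero hd⟩
  let φ : MvPolynomial (Fin d) R →ₐ[R] B := MvPolynomial.aeval y
  have hy0 : y i₀ ≠ 0 := by
    intro h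
    have := hy (MvPolynomial.X i₀) (by simp [h])
    simp at this
  obtain ⟨m, b, hb⟩ := hinv _ hy0
  -- The determinant `F` below has constant term `π ^ (m * r)`; the extra factor `π` is what puts
  -- the primitive part of `F` into `𝔪B`.
  let n := m * r + 1
  choose p w hw using fun j => he n (b * e j)
  -- Since `y i₀ * b = π ^ m`, multiplying the congruences for `b * e j` by `y i₀` shows that `M`,
  -- evaluated at `y`, kills `e` modulo `π ^ n`.
  let M : Matrix (Fin r) (Fin r) (MvPolynomial (Fin d) R) :=
    (MvPolynomial.C (π ^ m) : MvPolynomial (Fin d) R) •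
      (1 : Matrix (Fin r) (Fin r) (MvPolynomial (Fin d) R)) -
      (MvPolynomial.X i₀ : MvPolynomial (Fin d) R) • Matrix.of p
  let F := M.det
  have hF0 : MvPolynomial.constantCoeff F = π ^ (m * r) := by
    have : (MvPolynomial.constantCoeff (σ := Fin d) (R := R)).mapMatrix M = (π ^ m) • (1 : Matrix (Fin r) (Fin r) R) := by
      ext i j
      simp [M, Matrix.one_apply, apply_ite MvPolynomial.constantCoeff]
    rw [RingHom.map_det, this, Matrix.det_smul, Matrix.det_one, mul_one, Fintype.card_fin, pow_mul]
  let N : Matrix (Fin r) (Fin r) B := φ.toRingHom.mapMatrix M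
  have hN : N.mulVec e = algebraMap R B (π ^ n) • (fun j => y i₀ * w j) := by
    ext j
    have h1 : ∀ i, N j i = algebraMap R B (π ^ m) * (1 : Matrix (Fin r) (Fin r) B) j i
        - y i₀ * φ (p j i) := by
      intro i
      simp [N, M, φ, Matrix.one_apply]
      split_ifs <;> simp
    simp only [Matrix.mulVec, dotProduct, h1, sub_mul, Finset.sum_sub_distrib, mul_assoc,
      ← Finset.mul_sum, Pi.smul_apply, smul_eq_mul]
    rw [mul_left_comm, ← hw j, hb, mul_sub]
    simp [Matrix.one_apply, φ, mul_assoc]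
  have hdet : ∀ j, algebraMap R B (π ^ n) ∣ φ F * e j := by
    intro j
    have h1 : N.adjugate.mulVec (N.mulVec e) = φ F • e := by
      rw [Matrix.mulVec_mulVec, Matrix.adjugate_mul, Matrix.smul_mulVec, Matrix.one_mulVec]
      congr 1
      exact (RingHom.map_det φ.toRingHom M).symm
    rw [hN, Matrix.mulVec_smul] at h1
    exact ⟨_, (congrFun h1 j).symm⟩
  -- `1` is itself a combination of the `e i` modulo `π ^ n`.
  have hφF : algebraMap R B (π ^ n) ∣ φ F := by
    obtain ⟨p₁, hp₁⟩ := he n 1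
    have h1 : φ F = φ F * (1 - ∑ i, MvPolynomial.aeval y (p₁ i) * e i) +
        ∑ i, MvPolynomial.aeval y (p₁ i) * (φ F * e i) := by
      rw [mul_sub, Finset.mul_sum]
      simp [mul_left_comm]
    rw [h1]
    exact dvd_add (dvd_mul_of_dvd_right hp₁ _)
      (Finset.dvd_sum fun i _ => dvd_mul_of_dvd_right (hdet i) _)
  have hFne : F ≠ 0 := by
    intro h
    rw [h, map_zero] at hF0
    exact pow_ne_zero _ hπ0 hF0.symm
  -- The content `c` divides the constant term of `F`, so `π ^ n = c * (G(0) * π)`. Cancelling `c`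
  -- from `F(y) ∈ π ^ n B` leaves `G(y) ∈ 𝔪B`, against the independence of `y`.
  obtain ⟨c, G, hc, hFG, hG⟩ := exists_smul_map_residue_ne_zero F hFne
  apply hG
  have hG' : MvPolynomial.map (residue R) G = 0 := by
    apply hy
    obtain ⟨z, hz⟩ := hφF
    have hcd : π ^ n = c * (MvPolynomial.constantCoeff G * π) := by
      rw [pow_succ, ← hF0, hFG, MvPolynomial.constantCoeff_smul, smul_eq_mul, mul_assoc]
    refine (mem_map_maximalIdeal_iff _).mpr
      ⟨MvPolynomial.constantCoeff G * π, Ideal.mul_mem_left _ _ hπ, z, ?_⟩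
    have hc' : algebraMap R B c ≠ 0 := (map_ne_zero_iff _ hinj).mpr hc
    apply mul_left_cancel₀ hc'
    rw [← mul_assoc, ← map_mul, ← hcd, ← hz, hFG, map_smul, Algebra.smul_def]
  ext i
  exact congrArg (MvPolynomial.coeff i) hG'

omit [IsDomain R] [ValuationRing R] [IsDomain B] in
/-- A separated module over a complete ring is finite if it is finite modulo `π`. -/
theorem surjective_of_dense {π : R} [IsPrecomplete (Ideal.span {π}) R]
    (hsep : ∀ b : B, (∀ n, algebraMap R B (π ^ n) ∣ b) → b = 0) {r : ℕ} (e : Fin r → B)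
    (he : ∀ b : B, ∃ a : Fin r → R, algebraMap R B π ∣ b - ∑ i, algebraMap R B (a i) * e i)
    (b : B) : ∃ a : Fin r → R, b = ∑ i, algebraMap R B (a i) * e i := by
  choose a q hq using he
  -- `t n` is the remainder after `n` steps of a `π`-adic expansion of `b` in the `e i`; its
  -- coefficients `s i n` converge in `R`.
  let t : ℕ → B := fun n => q^[n] b
  have ht : ∀ n, t n = ∑ i, algebraMap R B (a (t n) i) * e i + algebraMap R B π * t (n + 1) := by
    intro n
    simp only [t, Function.iterate_succ_apply', ← hq]
    ring
  let s : Fin r → ℕ → R := fun i n => ∑ k ∈ Finset.range n, π ^ k * a (t k) i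
  have hs : ∀ n, b = ∑ i, algebraMap R B (s i n) * e i + algebraMap R B (π ^ n) * t n := by
    intro n
    induction n with
    | zero => simp [s, t]
    | succ n ih =>
      rw [ih, ht n]
      simp only [s, Finset.sum_range_succ, map_add, map_mul, add_mul, Finset.sum_add_distrib,
        mul_add, pow_succ, Finset.mul_sum]
      simp only [mul_assoc, add_assoc]
  have hcau : ∀ i {m n : ℕ}, m ≤ n → s i m ≡ s i n [SMOD (Ideal.span {π} ^ m • ⊤ : Ideal R)] := by
    intro i m n hmn
    rw [SModEq.comm, SModEq.sub_mem, smul_eq_mul, Ideal.mul_top, Ideal.span_singleton_pow,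
      Ideal.mem_span_singleton, Finset.sum_range_sub_sum_range hmn]
    refine Finset.dvd_sum fun k hk => dvd_mul_of_dvd_left (pow_dvd_pow _ ?_) _
    exact (Finset.mem_filter.mp hk).2
  choose l hl using fun i => IsPrecomplete.prec (I := Ideal.span {π}) inferInstance (hcau i)
  refine ⟨l, sub_eq_zero.mp (hsep _ fun n => ?_)⟩
  have h1 : b - ∑ i, algebraMap R B (l i) * e i =
      ∑ i, algebraMap R B (s i n - l i) * e i + algebraMap R B (π ^ n) * t n := by
    nth_rw 1 [hs n]
    simp only [map_sub, sub_mul, Finset.sum_sub_distrib]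
    ring
  rw [h1]
  refine dvd_add (Finset.dvd_sum fun i _ => dvd_mul_of_dvd_left ((algebraMap R B).map_dvd ?_) _)
    (dvd_mul_right _ _)
  have := hl i n
  rwa [SModEq.sub_mem, smul_eq_mul, Ideal.mul_top, Ideal.span_singleton_pow,
      Ideal.mem_span_singleton] at this

/-- An algebra that is topologically of finite type over the complete valuation ring `R` of rank
one, and that becomes a field when `π` is inverted, is finite over `R`. -/
theorem finite_of_topologically_finiteType {π : R} (hπ0 : π ≠ 0) (hπ : π ∈ maximalIdeal R)
    (hrad : ∀ c ∈ maximalIdeal R, ∃ n, π ∣ c ^ n) [IsPrecomplete (Ideal.span {π}) R]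
    (hinj : Function.Injective (algebraMap R B))
    (hinv : ∀ b : B, b ≠ 0 → ∃ n : ℕ, b ∣ algebraMap R B (π ^ n)) (X : Finset B)
    (hX : ∀ b : B, ∃ p ∈ Algebra.adjoin R (X : Set B), algebraMap R B π ∣ b - p)
    (htop : (maximalIdeal R).map (algebraMap R B) ≠ ⊤) : Module.Finite R B := by
  classical
  obtain ⟨d, y, hy, r, e, he⟩ := exists_noether_normalization hπ hrad X hX htop
  obtain rfl := noether_dimension_eq_zero hπ0 hπ hinj hinv y hy e he
  -- If `b` divides `π ^ n` and is divisible by `π ^ (n + 1)`, then `π` is a unit of `B`, contrary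
  -- to `𝔪B ≠ B`.
  have hsep : ∀ b : B, (∀ n, algebraMap R B (π ^ n) ∣ b) → b = 0 := by
    intro b hb
    by_contra hb0
    obtain ⟨n, z, hz⟩ := hinv b hb0
    obtain ⟨w, hw⟩ := hb (n + 1)
    have hπn : algebraMap R B (π ^ n) ≠ 0 := (map_ne_zero_iff _ hinj).mpr (pow_ne_zero _ hπ0)
    have h1 : (1 : B) = algebraMap R B π * (w * z) := by
      apply mul_left_cancel₀ hπn
      rw [mul_one, ← mul_assoc, ← map_mul, ← pow_succ, ← mul_assoc, ← hw, hz]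
    exact htop ((Ideal.eq_top_iff_one _).mpr ((mem_map_maximalIdeal_iff _).mpr ⟨π, hπ, _, h1⟩))
  have he' : ∀ b : B, ∃ a : Fin r → R,
      algebraMap R B π ∣ b - ∑ i, algebraMap R B (a i) * e i := by
    intro b
    obtain ⟨p, hp⟩ := he 1 b
    refine ⟨fun i => MvPolynomial.constantCoeff (p i), ?_⟩
    have h1 : ∀ i, MvPolynomial.aeval y (p i) =
        algebraMap R B (MvPolynomial.constantCoeff (p i)) := by
      intro i
      conv_lhs => rw [MvPolynomial.eq_C_of_isEmpty (p i)]
      simp [MvPolynomial.constantCoeff_eq]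
    simpa [h1] using hp
  refine ⟨⟨Finset.univ.image e, ?_⟩⟩
  rw [eq_top_iff]
  rintro b -
  obtain ⟨a, rfl⟩ := surjective_of_dense hsep e he' b
  refine Submodule.sum_mem _ fun i _ => ?_
  rw [← Algebra.smul_def]
  exact Submodule.smul_mem _ _ (Submodule.subset_span (by simp))

end Finiteness

/-! ### Pseudo-uniformizers and algebras of topologically finite type -/

section Definitions

open IsLocalRing

/-- `π` is a pseudo-uniformizer of a complete valuation ring of rank one. -/
structure IsPseudoUniformizer {R : Type*} [CommRing R] [IsLocalRing R] (π : R) : Prop where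
  ne_zero : π ≠ 0
  mem : π ∈ maximalIdeal R
  dvd_pow : ∀ c ∈ maximalIdeal R, ∃ n, π ∣ c ^ n
  dvd_pow_self : ∀ c : R, c ≠ 0 → ∃ n, c ∣ π ^ n
  isPrecomplete : IsPrecomplete (Ideal.span {π}) R

/-- The properties of `π`-complete algebras topologically of finite type that survive suitable
localizations. -/
structure IsTopologicallyFiniteType {R : Type*} [CommRing R] [IsLocalRing R] (π : R)
    (B : Type*) [CommRing B] [Algebra R B] : Prop where
  map_le_jacobson : (maximalIdeal R).map (algebraMap R B) ≤ (⊥ : Ideal B).jacobson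
  finiteType : Algebra.FiniteType R (B ⧸ Ideal.span {algebraMap R B π})

theorem exists_finset_of_finiteType_quotient {R B : Type*} [CommRing R] [CommRing B] [Algebra R B]
    (t : B) (h : Algebra.FiniteType R (B ⧸ Ideal.span {t})) :
    ∃ X : Finset B, ∀ b : B, ∃ p ∈ Algebra.adjoin R (X : Set B), t ∣ b - p := by
  classical
  obtain ⟨T, hT⟩ := h.out
  let m := Ideal.Quotient.mkₐ R (Ideal.span {t})
  have hm : Function.Surjective m := Ideal.Quotient.mkₐ_surjective _ _
  choose f hf using hm
  refine ⟨T.image f, fun b => ?_⟩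
  have hb : m b ∈ (Algebra.adjoin R ((T.image f : Finset B) : Set B)).map m := by
    rw [← Algebra.adjoin_image, Finset.coe_image, Set.image_image]
    simp [hf, hT]
  obtain ⟨p, hp, hpb⟩ := hb
  exact ⟨p, hp, Ideal.mem_span_singleton.mp (Ideal.Quotient.eq.mp hpb.symm)⟩

end Definitions

/-! ### Points of the generic fibre -/

section Points

open IsLocalRing

variable {R : Type*} [CommRing R] [IsDomain R] [ValuationRing R] {π : R} {B : Type*} [CommRing B]
  [Algebra R B]

/-- The image of `B` in a field obtained by inverting `π` is integral over `R`. -/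
theorem IsTopologicallyFiniteType.isIntegral (hB : IsTopologicallyFiniteType π B)
    (hπ : IsPseudoUniformizer π) {L : Type*} [Field L] [Algebra R L]
    (hinj : Function.Injective (algebraMap R L)) (ψ : B →ₐ[R] L)
    (hψ : ∀ l : L, ∃ n b, algebraMap R L (π ^ n) * l = ψ b) (b : B) : IsIntegral R (ψ b) := by
  classical
  have := hπ.isPrecomplete
  obtain ⟨X, hX⟩ := exists_finset_of_finiteType_quotient _ hB.finiteType
  have hfin : Module.Finite R ψ.range := by
    refine finite_of_topologically_finiteType hπ.ne_zero hπ.mem hπ.dvd_pow (fun a b hab => ?_) ?_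
      (X.image ψ.rangeRestrict) ?_ ?_
    · exact hinj (congrArg Subtype.val hab)
    · rintro ⟨l, hl⟩ hl0
      obtain ⟨n, b, hb⟩ := hψ l⁻¹
      refine ⟨n, ⟨ψ b, b, rfl⟩, Subtype.ext ?_⟩
      have hl0' : l ≠ 0 := fun h => hl0 (Subtype.ext h)
      change algebraMap R L (π ^ n) = l * ψ b
      rw [← hb, mul_left_comm, mul_inv_cancel₀ hl0', mul_one]
    · intro l
      obtain ⟨b, rfl⟩ := ψ.rangeRestrict_surjective l
      obtain ⟨p, hp, hd⟩ := hX b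
      refine ⟨ψ.rangeRestrict p, ?_, ?_⟩
      · rw [Finset.coe_image, Algebra.adjoin_image]
        exact ⟨p, hp, rfl⟩
      · simpa using map_dvd ψ.rangeRestrict hd
    -- If `1 = c * ψ b` with `c ∈ 𝔪`, then the unit `1 - c * b` of `B` maps to `0`.
    · intro htop
      obtain ⟨c, hc, l, hl⟩ := (mem_map_maximalIdeal_iff _).mp ((Ideal.eq_top_iff_one _).mp htop)
      obtain ⟨b, rfl⟩ := ψ.rangeRestrict_surjective l
      have h1 : algebraMap R B c ∈ (⊥ : Ideal B).jacobson :=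
        hB.map_le_jacobson (Ideal.mem_map_of_mem _ hc)
      have h2 := (Ideal.mem_jacobson_bot.mp h1 (-b)).map ψ
      have h3 : (1 : L) = algebraMap R L c * ψ b := congrArg Subtype.val hl
      simp [← h3] at h2
  have : IsIntegral R (ψ.rangeRestrict b) := Algebra.IsIntegral.isIntegral _
  exact this.map ψ.range.val

variable (K : Type*) [Field K] [Algebra R K] [IsFractionRing R K]

omit [IsDomain R] [ValuationRing R] in
theorem exists_pow_mul_eq_tmul [IsLocalRing R] (hπ : IsPseudoUniformizer π) (a : K ⊗[R] B) :
    ∃ (n : ℕ) (b : B), π ^ n • a = 1 ⊗ₜ b := by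
  induction a with
  | zero => exact ⟨0, 0, by simp⟩
  | tmul k b =>
    obtain ⟨r, s, hs, rfl⟩ := IsFractionRing.div_surjective (A := R) k
    have hs0 : algebraMap R K s ≠ 0 := IsFractionRing.to_map_ne_zero_of_mem_nonZeroDivisors hs
    have : Nontrivial R := ⟨π, 0, hπ.ne_zero⟩
    obtain ⟨n, t, ht⟩ := hπ.dvd_pow_self s (nonZeroDivisors.ne_zero hs)
    refine ⟨n, (r * t) • b, ?_⟩
    rw [TensorProduct.smul_tmul', TensorProduct.tmul_smul, TensorProduct.smul_tmul']
    congr 1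
    rw [ht, Algebra.smul_def, Algebra.smul_def, map_mul, map_mul]
    field_simp
  | add x y hx hy =>
    obtain ⟨n, b, hb⟩ := hx
    obtain ⟨m, b', hb'⟩ := hy
    refine ⟨n + m, π ^ m • b + π ^ n • b', ?_⟩
    rw [smul_add, pow_add, mul_smul, mul_smul, smul_comm, hb, hb', TensorProduct.tmul_add,
      TensorProduct.tmul_smul, TensorProduct.tmul_smul]

/-- The residue fields of `K ⊗ B` are algebraic over `K`, and `B` is integral over `R` in them. -/
theorem IsTopologicallyFiniteType.isIntegral_tmul (hB : IsTopologicallyFiniteType π B)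
    (hπ : IsPseudoUniformizer π) (x : Ideal (K ⊗[R] B)) [hx : x.IsMaximal] (b : B) :
    IsIntegral R (Ideal.Quotient.mk x (1 ⊗ₜ b)) := by
  let : Field ((K ⊗[R] B) ⧸ x) := Ideal.Quotient.field x
  refine hB.isIntegral hπ (L := (K ⊗[R] B) ⧸ x) ?_
    ((Ideal.Quotient.mkₐ R x).comp Algebra.TensorProduct.includeRight) ?_ b
  · rw [IsScalarTower.algebraMap_eq R K ((K ⊗[R] B) ⧸ x)]
    exact (algebraMap K _).injective.comp (IsFractionRing.injective R K)
  · intro l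
    obtain ⟨a, rfl⟩ := Ideal.Quotient.mk_surjective l
    obtain ⟨n, b, hb⟩ := exists_pow_mul_eq_tmul K hπ a
    refine ⟨n, b, ?_⟩
    rw [← Algebra.smul_def]
    exact congrArg (Ideal.Quotient.mkₐ R x) hb

theorem IsTopologicallyFiniteType.isAlgebraic_quotient (hB : IsTopologicallyFiniteType π B)
    (hπ : IsPseudoUniformizer π) (x : Ideal (K ⊗[R] B)) [hx : x.IsMaximal] :
    Algebra.IsAlgebraic K ((K ⊗[R] B) ⧸ x) := by
  refine ⟨fun l => ?_⟩
  obtain ⟨a, rfl⟩ := Ideal.Quotient.mk_surjective l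
  obtain ⟨n, b, hb⟩ := exists_pow_mul_eq_tmul K hπ a
  have hπK : algebraMap R K (π ^ n) ≠ 0 :=
    (map_ne_zero_iff _ (IsFractionRing.injective R K)).mpr (pow_ne_zero _ hπ.ne_zero)
  have h1 : IsAlgebraic K (Ideal.Quotient.mk x (1 ⊗ₜ b)) :=
    ((hB.isIntegral_tmul K hπ x b).tower_top (A := K)).isAlgebraic
  have h2 : Ideal.Quotient.mk x a = algebraMap K ((K ⊗[R] B) ⧸ x) (algebraMap R K (π ^ n))⁻¹ *
      Ideal.Quotient.mk x ((1 : K) ⊗ₜ[R] b) := by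
    rw [← hb, ← algebraMap_smul K (π ^ n) a, Algebra.smul_def, map_mul, ← mul_assoc]
    change _ = algebraMap K ((K ⊗[R] B) ⧸ x) _ * algebraMap K ((K ⊗[R] B) ⧸ x) _ * _
    rw [← map_mul, inv_mul_cancel₀ hπK, map_one, one_mul]
  rw [h2]
  exact (isAlgebraic_algebraMap _).mul h1

/-- The localization of `B` at the elements whose image in a reduction `C` of `B` is a power of
the image of `p`. -/
theorem IsTopologicallyFiniteType.localization (hB : IsTopologicallyFiniteType π B)
    (hπ : IsPseudoUniformizer π) {C : Type*} [CommRing C] [Algebra R C] (ρ : B →ₐ[R] C)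
    (hC : ∀ c ∈ maximalIdeal R, algebraMap R C c = 0)
    (hρ : ∀ b, ρ b = 0 → ∃ c ∈ maximalIdeal R, algebraMap R B c ∣ b) (p : B) :
    IsTopologicallyFiniteType π
      (Localization ((Submonoid.powers (ρ p)).comap ρ)) := by
  classical
  set W := (Submonoid.powers (ρ p)).comap ρ with hW
  have hunit : ∀ w ∈ W, IsUnit (algebraMap B (Localization W) w) := fun w hw =>
    IsLocalization.map_units (Localization W) (⟨w, hw⟩ : W)
  refine ⟨?_, ?_⟩
  · rw [Ideal.map_le_iff_le_comap]
    intro c hc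
    rw [Ideal.mem_comap, Ideal.mem_jacobson_bot]
    intro y
    obtain ⟨b, w, rfl⟩ := IsLocalization.exists_mk'_eq W y
    -- `c * b + w` has the same reduction as `w`. This is why `W` is the full preimage and not just
    -- the powers of `p`.
    have hw' : algebraMap R B c * b + w ∈ W := by
      change ρ _ ∈ Submonoid.powers _
      rw [map_add, map_mul, AlgHom.commutes, hC c hc, zero_mul, zero_add]
      exact w.2
    have h1 := hunit _ hw'
    have h2 : (algebraMap R (Localization W) c * IsLocalization.mk' (Localization W) b w + 1) *
        algebraMap B (Localization W) w =
        algebraMap B (Localization W) (algebraMap R B c * b + w) := by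
      rw [add_mul, mul_assoc, IsLocalization.mk'_spec, one_mul, map_add, map_mul,
        ← IsScalarTower.algebraMap_apply]
    exact isUnit_of_mul_isUnit_left (h2 ▸ h1)
  · set B₁ := Localization W
    let I := Ideal.span {algebraMap R B π}
    let J := Ideal.span {algebraMap R B₁ π}
    have hIJ : I ≤ J.comap (IsScalarTower.toAlgHom R B B₁) := by
      rw [Ideal.span_singleton_le_iff_mem, Ideal.mem_comap]
      exact Ideal.mem_span_singleton_self _
    let j : B ⧸ I →ₐ[R] B₁ ⧸ J := Ideal.quotientMapₐ J (IsScalarTower.toAlgHom R B B₁) hIJ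
    have hp : p ∈ W := Submonoid.mem_powers _
    obtain ⟨u, hu⟩ := (hunit p hp).exists_right_inv
    obtain ⟨T, hT⟩ := hB.finiteType.out
    let m := Ideal.Quotient.mkₐ R J
    let D := Algebra.adjoin R ((insert (m u) (T.image j) : Finset (B₁ ⧸ J)) : Set (B₁ ⧸ J))
    have hBD : ∀ b : B, m (algebraMap B B₁ b) ∈ D := by
      intro b
      have h1 : j.range ≤ D := by
        rw [← Algebra.map_top, ← hT, ← Algebra.adjoin_image]
        exact Algebra.adjoin_mono (by simp)
      exact h1 ⟨Ideal.Quotient.mk I b, rfl⟩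
    have huD : m u ∈ D := Algebra.subset_adjoin (by simp)
    refine ⟨⟨_, (?_ : D = ⊤)⟩⟩
    rw [eq_top_iff]
    rintro z -
    obtain ⟨y, rfl⟩ := Ideal.Quotient.mkₐ_surjective R J z
    obtain ⟨b, ⟨w, hw⟩, rfl⟩ := IsLocalization.exists_mk'_eq W y
    obtain ⟨a, ha⟩ := id hw
    -- `w = p ^ a + c * b'` with `c` nilpotent modulo `π`. Hence modulo `π` the inverse of `w` is `u
    -- ^ a * (1 + u ^ a * b' * c)⁻¹`, and the second factor already exists in `D`.
    obtain ⟨c, hc, b', hb'⟩ := hρ (w - p ^ a) (by rw [map_sub, map_pow]; simpa using ha ▸ sub_self _)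
    obtain ⟨N, hN⟩ := hπ.dvd_pow c hc
    let t : D := ⟨m u, huD⟩ ^ a * ⟨m (algebraMap B B₁ b'), hBD b'⟩ * algebraMap R D c
    have htnil : IsNilpotent t := by
      refine ⟨N, ?_⟩
      have h1 : (algebraMap R D c) ^ N = 0 := by
        rw [← map_pow]
        obtain ⟨s, hs⟩ := hN
        apply Subtype.ext
        have h2 : algebraMap R (B₁ ⧸ J) π = 0 :=
          Ideal.Quotient.eq_zero_iff_mem.mpr (Ideal.mem_span_singleton_self _)
        change algebraMap R (B₁ ⧸ J) (c ^ N) = 0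
        rw [hs, map_mul, h2, zero_mul]
      rw [mul_pow, h1, mul_zero]
    obtain ⟨s, hs⟩ := htnil.isUnit_one_add.exists_right_inv
    have hs' : (1 + m u ^ a * m (algebraMap B B₁ b') * m (algebraMap R B₁ c)) * s = 1 :=
      congrArg Subtype.val hs
    have hwz : m (algebraMap B B₁ w) * (m u ^ a * s) = 1 := by
      have h1 : w = p ^ a + algebraMap R B c * b' := by rw [← hb']; ring
      have h2 : m (algebraMap B B₁ p) * m u = 1 := by rw [← map_mul, hu, map_one]
      have h3 : m (algebraMap B B₁ p) ^ a * m u ^ a = 1 := by rw [← mul_pow, h2, one_pow]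
      rw [← hs', h1, map_add, map_add, map_mul, map_mul, map_pow, map_pow,
        ← IsScalarTower.algebraMap_apply, ← h3]
      ring
    have hz : m (IsLocalization.mk' B₁ b ⟨w, hw⟩) =
        m (algebraMap B B₁ b) * (m u ^ a * s) := by
      have h1 := congrArg m (IsLocalization.mk'_spec B₁ b (⟨w, hw⟩ : W))
      rw [← h1, map_mul, mul_assoc, hwz, mul_one]
    rw [hz]
    exact mul_mem (hBD b) (mul_mem (pow_mem huD a) s.2)

/-- An element of `B` whose reduction is not nilpotent becomes a unit of the integral closure of
`R` at some point of `K ⊗ B`. -/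
theorem IsTopologicallyFiniteType.exists_maximal_isIntegral_inv
    (hB : IsTopologicallyFiniteType π B)
    (hπ : IsPseudoUniformizer π) {C : Type*} [CommRing C] [Algebra R C] (ρ : B →ₐ[R] C)
    (hC : ∀ c ∈ maximalIdeal R, algebraMap R C c = 0)
    (hρ : ∀ b, ρ b = 0 → ∃ c ∈ maximalIdeal R, algebraMap R B c ∣ b)
    (htors : ∀ (n : ℕ) (b : B), algebraMap R B (π ^ n) * b = 0 → ρ b = 0)
    (p : B) (hp : ¬ IsNilpotent (ρ p)) :
    ∃ x : MaximalSpectrum (K ⊗[R] B), ∃ z : (K ⊗[R] B) ⧸ x.asIdeal,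
      IsIntegral R z ∧ Ideal.Quotient.mk x.asIdeal (1 ⊗ₜ p) * z = 1 := by
  set W := (Submonoid.powers (ρ p)).comap ρ with hW
  have hB₁ : IsTopologicallyFiniteType π (Localization W) := hB.localization hπ ρ hC hρ p
  set B₁ := Localization W
  -- If the generic fibre vanished, some `π ^ n` would be zero in `B₁`, hence killed in `B` by an
  -- element of `W`. By `htors` its reduction, a power of `ρ p`, would be zero.
  have hnt : Nontrivial (K ⊗[R] B₁) := by
    refine ⟨1 ⊗ₜ 1, 0, fun h => ?_⟩
    have : IsLocalizedModule (nonZeroDivisors R) (TensorProduct.mk R K B₁ 1) :=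
      (isLocalizedModule_iff_isBaseChange (nonZeroDivisors R) K _).mpr
        (TensorProduct.isBaseChange R B₁ K)
    obtain ⟨⟨s, hs⟩, h1⟩ := (IsLocalizedModule.eq_zero_iff (nonZeroDivisors R)
      (TensorProduct.mk R K B₁ 1)).mp h
    obtain ⟨n, t, ht⟩ := hπ.dvd_pow_self s (nonZeroDivisors.ne_zero hs)
    have h2 : algebraMap B B₁ (algebraMap R B (π ^ n)) = 0 := by
      rw [← IsScalarTower.algebraMap_apply, ht, mul_comm, map_mul]
      have h1' : algebraMap R B₁ s = 0 := by
        rw [Algebra.algebraMap_eq_smul_one]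
        exact h1
      rw [h1', mul_zero]
    obtain ⟨⟨w, a, ha⟩, hw⟩ := (IsLocalization.map_eq_zero_iff W B₁ _).mp h2
    refine hp ⟨a, ?_⟩
    have h3 := htors n w (by rw [mul_comm]; exact hw)
    rw [← h3]
    exact ha
  obtain ⟨y, hy⟩ := Ideal.exists_maximal (K ⊗[R] B₁)
  let : Field ((K ⊗[R] B₁) ⧸ y) := Ideal.Quotient.field y
  have halg := hB₁.isAlgebraic_quotient K hπ y
  let f : K ⊗[R] B →ₐ[K] (K ⊗[R] B₁) ⧸ y := (Ideal.Quotient.mkₐ K y).comp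
    (Algebra.TensorProduct.map (AlgHom.id K K) (IsScalarTower.toAlgHom R B B₁))
  -- The residue field at `y` is algebraic over `K`, so `f` is integral and its kernel is maximal.
  have hf : f.toRingHom.IsIntegral := by
    apply RingHom.IsIntegral.tower_top (algebraMap K _)
    have : f.toRingHom.comp (algebraMap K _) = algebraMap K _ := f.comp_algebraMap
    rw [this]
    exact (Algebra.IsAlgebraic.isIntegral (K := K)).isIntegral
  have hmax : (RingHom.ker f).IsMaximal :=
    Ideal.isMaximal_comap_of_isIntegral_of_isMaximal' f.toRingHom hf ⊥
  let g : (K ⊗[R] B) ⧸ RingHom.ker f →ₐ[K] (K ⊗[R] B₁) ⧸ y := Ideal.kerLiftAlg f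
  have hg : Function.Injective g := Ideal.kerLiftAlg_injective f
  have hgp : g (Ideal.Quotient.mk _ (1 ⊗ₜ p)) =
      Ideal.Quotient.mk y (1 ⊗ₜ algebraMap B B₁ p) := rfl
  obtain ⟨u, hu⟩ := (IsLocalization.map_units B₁ (⟨p, Submonoid.mem_powers _⟩ : W)).exists_right_inv
  have hgu : g (Ideal.Quotient.mk _ (1 ⊗ₜ p)) * Ideal.Quotient.mk y (1 ⊗ₜ u) = 1 := by
    rw [hgp, ← map_mul, Algebra.TensorProduct.tmul_mul_tmul, hu, mul_one]
    exact map_one _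
  let : Field ((K ⊗[R] B) ⧸ RingHom.ker f) := Ideal.Quotient.field _
  have hp0 : Ideal.Quotient.mk (RingHom.ker f) (1 ⊗ₜ p) ≠ 0 := by
    intro h
    rw [h, map_zero, zero_mul] at hgu
    exact zero_ne_one hgu
  refine ⟨⟨RingHom.ker f, hmax⟩, (Ideal.Quotient.mk (RingHom.ker f) (1 ⊗ₜ p))⁻¹, ?_,
    mul_inv_cancel₀ hp0⟩
  have h1 : g (Ideal.Quotient.mk (RingHom.ker f) (1 ⊗ₜ p))⁻¹ = Ideal.Quotient.mk y (1 ⊗ₜ u) := by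
    rw [map_inv₀]
    exact inv_eq_of_mul_eq_one_right hgu
  -- `u` is integral at `y`, and integrality descends along the injection `g`.
  have h2 := hB₁.isIntegral_tmul K hπ y u
  rw [← h1] at h2
  exact (isIntegral_algHom_iff (g.restrictScalars R) hg).mp h2

end Points

/-! ### The completed semigroup algebra and its reduction -/

section Completion

open IsLocalRing

variable {R : Type*} [CommRing R] (π : R) (S : Type*)
  [AddCommMonoid S]

/-- The ideal `π R[S]`. -/
noncomputable abbrev semigroupIdeal : Ideal (AddMonoidAlgebra R S) :=
  Ideal.span {algebraMap R (AddMonoidAlgebra R S) π}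

/-- The `π`-adic completion of the semigroup algebra `R[S]`. -/
noncomputable abbrev SemigroupCompletion : Type _ :=
  AdicCompletion (semigroupIdeal π S) (AddMonoidAlgebra R S)

theorem ker_evalOne_eq_span :
    RingHom.ker (AdicCompletion.evalOneₐ (semigroupIdeal π S)).toRingHom =
      Ideal.span {algebraMap R (SemigroupCompletion π S) π} := by
  rw [AdicCompletion.ker_evalOneₐ_eq_map _ (Submodule.fg_span_singleton _), Ideal.map_span,
    Set.image_singleton, ← IsScalarTower.algebraMap_apply]

/-- The completion at a principal ideal is complete for the extended ideal, so each `1 + π b` is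
invertible. -/
theorem mem_jacobson :
    algebraMap R (SemigroupCompletion π S) π ∈ (⊥ : Ideal (SemigroupCompletion π S)).jacobson := by
  have h1 : IsAdicComplete (semigroupIdeal π S) (SemigroupCompletion π S) :=
    AdicCompletion.isAdicComplete (Submodule.fg_span_singleton _)
  have h2 := (IsAdicComplete.map_algebraMap_iff (S := SemigroupCompletion π S)
    (semigroupIdeal π S) (SemigroupCompletion π S)).mpr h1
  refine IsAdicComplete.le_jacobson_bot ((semigroupIdeal π S).map
    (algebraMap (AddMonoidAlgebra R S) (SemigroupCompletion π S))) ?_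
  rw [IsScalarTower.algebraMap_apply R (AddMonoidAlgebra R S)]
  exact Ideal.mem_map_of_mem _ (Ideal.mem_span_singleton_self _)

variable {π S}

theorem exists_eq_algebraMap_add (b : SemigroupCompletion π S) :
    ∃ (P : AddMonoidAlgebra R S) (b' : SemigroupCompletion π S),
      b = algebraMap _ _ P + algebraMap R _ π * b' := by
  obtain ⟨P, hP⟩ := Ideal.Quotient.mk_surjective (AdicCompletion.evalOneₐ (semigroupIdeal π S) b)
  have h1 : b - algebraMap _ _ P ∈
      RingHom.ker (AdicCompletion.evalOneₐ (semigroupIdeal π S)).toRingHom := by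
    rw [RingHom.mem_ker]
    change AdicCompletion.evalOneₐ (semigroupIdeal π S) _ = 0
    rw [map_sub, AlgHom.commutes, ← hP]
    exact sub_self _
  rw [ker_evalOne_eq_span, Ideal.mem_span_singleton] at h1
  obtain ⟨b', hb'⟩ := h1
  exact ⟨P, b', by rw [← hb']; ring⟩

theorem finiteType_quotient [AddMonoid.FG S] :
    Algebra.FiniteType R (SemigroupCompletion π S ⧸
      Ideal.span {algebraMap R (SemigroupCompletion π S) π}) := by
  refine Algebra.FiniteType.of_surjective (A := AddMonoidAlgebra R S)
    ((Ideal.Quotient.mkₐ R _).comp (IsScalarTower.toAlgHom R _ _)) fun z => ?_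
  obtain ⟨b, rfl⟩ := Ideal.Quotient.mk_surjective z
  obtain ⟨P, b', hb⟩ := exists_eq_algebraMap_add b
  refine ⟨P, Ideal.Quotient.eq.mpr (Ideal.mem_span_singleton.mpr ⟨-b', ?_⟩)⟩
  rw [hb]
  simp

theorem evalₐ_pow_mul_eq_zero (n : ℕ) (b : SemigroupCompletion π S) :
    AdicCompletion.evalₐ (semigroupIdeal π S) n
      (algebraMap R (SemigroupCompletion π S) (π ^ n) * b) = 0 := by
  rw [map_mul, IsScalarTower.algebraMap_apply R (AddMonoidAlgebra R S), AlgHom.commutes]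
  have h1 : algebraMap (AddMonoidAlgebra R S) (AddMonoidAlgebra R S ⧸ semigroupIdeal π S ^ n)
      (algebraMap R _ (π ^ n)) = 0 := by
    refine Ideal.Quotient.eq_zero_iff_mem.mpr ?_
    rw [map_pow]
    exact Ideal.pow_mem_pow (Ideal.mem_span_singleton_self _) n
  rw [h1, zero_mul]

variable [IsLocalRing R]

/-- Each `c ∈ 𝔪` has a power divisible by `π`, and a Jacobson radical is a radical ideal. -/
theorem isTopologicallyFiniteType_semigroupCompletion [AddMonoid.FG S]
    (hπ : IsPseudoUniformizer π) : IsTopologicallyFiniteType π (SemigroupCompletion π S) := by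
  refine ⟨?_, finiteType_quotient⟩
  rw [Ideal.map_le_iff_le_comap]
  intro c hc
  obtain ⟨n, hn⟩ := hπ.dvd_pow c hc
  rw [Ideal.mem_comap]
  have h1 : (⊥ : Ideal (SemigroupCompletion π S)).jacobson.IsRadical :=
    Ideal.isRadical_jacobson _
  refine h1 ⟨n, ?_⟩
  rw [← map_pow]
  obtain ⟨d, hd⟩ := hn
  rw [hd, map_mul]
  exact Ideal.mul_mem_right _ _ (mem_jacobson π S)

/-- The reduction `R[S] → k[S]`. -/
noncomputable abbrev semigroupReduction :
    AddMonoidAlgebra R S →ₐ[R] AddMonoidAlgebra (ResidueField R) S :=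
  AddMonoidAlgebra.mapAlgHom S (Algebra.ofId R (ResidueField R))

/-- The reduction of the completion of `R[S]` with values in `k[S]`. -/
noncomputable def completionReduction (hπ : π ∈ maximalIdeal R) :
    SemigroupCompletion π S →ₐ[R] AddMonoidAlgebra (ResidueField R) S :=
  (Ideal.Quotient.liftₐ (semigroupIdeal π S) semigroupReduction (by
    intro a ha
    have h1 : semigroupIdeal π S ≤ RingHom.ker
        (semigroupReduction (R := R) (S := S)) := by
      rw [Ideal.span_singleton_le_iff_mem, RingHom.mem_ker, AlgHom.commutes,
        IsScalarTower.algebraMap_apply R (ResidueField R), ResidueField.algebraMap_eq,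
        (residue_eq_zero_iff π).mpr hπ, map_zero]
    exact h1 ha)).comp
    ((AdicCompletion.evalOneₐ (semigroupIdeal π S)).restrictScalars R)

@[simp]
theorem completionReduction_algebraMap (hπ : π ∈ maximalIdeal R) (P : AddMonoidAlgebra R S) :
    completionReduction hπ (algebraMap _ (SemigroupCompletion π S) P) = semigroupReduction P := by
  rfl

theorem algebraMap_semigroupAlgebra_eq_zero {c : R} (hc : c ∈ maximalIdeal R) :
    algebraMap R (AddMonoidAlgebra (ResidueField R) S) c = 0 := by
  rw [IsScalarTower.algebraMap_apply R (ResidueField R), ResidueField.algebraMap_eq,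
    (residue_eq_zero_iff c).mpr hc, map_zero]

end Completion

/-! ### The Gauss norm on the completion -/

section Valuation

open IsLocalRing

variable {R : Type*} [CommRing R] [IsDomain R] [ValuationRing R] {π : R} {S : Type*}
  [AddCommMonoid S]

/-- Write `b = P + π b'`. If `P ≠ 0`, its content lies in `𝔪`, and whichever of this content and `π`
divides the other divides `b`. -/
theorem exists_dvd_of_completionReduction_eq_zero (hπ : π ∈ maximalIdeal R)
    (b : SemigroupCompletion π S) (hb : completionReduction hπ b = 0) :
    ∃ c ∈ maximalIdeal R, algebraMap R (SemigroupCompletion π S) c ∣ b := by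
  obtain ⟨P, b', rfl⟩ := exists_eq_algebraMap_add b
  rw [map_add, map_mul, AlgHom.commutes, algebraMap_semigroupAlgebra_eq_zero hπ, zero_mul,
    add_zero, completionReduction_algebraMap] at hb
  by_cases hP : P = 0
  · exact ⟨π, hπ, b', by simp [hP]⟩
  obtain ⟨c, G, hc, rfl, hG⟩ := exists_smul_map_residue_ne_zero P hP
  have hcm : c ∈ maximalIdeal R := by
    by_contra h
    have hu : IsUnit c := by simpa using h
    obtain ⟨d, hd⟩ := hu.exists_left_inv
    apply hG
    have h1 := congrArg (fun z => d • z) hb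
    simp only [smul_zero, ← map_smul, smul_smul, hd, one_smul] at h1
    exact h1
  have h2 : algebraMap R (SemigroupCompletion π S) c ∣
      algebraMap (AddMonoidAlgebra R S) (SemigroupCompletion π S) (c • G) :=
    ⟨algebraMap _ _ G, by
      rw [Algebra.smul_def, map_mul, ← IsScalarTower.algebraMap_apply]⟩
  rcases ValuationRing.dvd_total c π with h | h
  · exact ⟨c, hcm, dvd_add h2 (dvd_mul_of_dvd_left ((algebraMap _ _).map_dvd h) _)⟩
  · exact ⟨π, hπ, dvd_add (((algebraMap _ _).map_dvd h).trans h2) (dvd_mul_right _ _)⟩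

/-- With `b = P + π b'`, the relation modulo `π ^ (n + 1)` puts `π ^ n P` in `π ^ (n + 1) R[S]`. As
`R[S]` is torsion-free, `P ∈ π R[S]`. -/
theorem completionReduction_eq_zero_of_torsion (hπ0 : π ≠ 0) (hπ : π ∈ maximalIdeal R) (n : ℕ)
    (b : SemigroupCompletion π S) (hb : algebraMap R _ (π ^ n) * b = 0) :
    completionReduction hπ b = 0 := by
  obtain ⟨P, b', rfl⟩ := exists_eq_algebraMap_add b
  rw [map_add, map_mul, AlgHom.commutes, algebraMap_semigroupAlgebra_eq_zero hπ, zero_mul,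
    add_zero, completionReduction_algebraMap]
  have h1 := evalₐ_pow_mul_eq_zero (n + 1) b'
  have h2 : AdicCompletion.evalₐ (semigroupIdeal π S) (n + 1)
      (algebraMap _ (SemigroupCompletion π S) (algebraMap R _ (π ^ n) * P)) = 0 := by
    have h3 : algebraMap _ (SemigroupCompletion π S) (algebraMap R _ (π ^ n) * P) =
        - (algebraMap R (SemigroupCompletion π S) (π ^ (n + 1)) * b') := by
      rw [map_mul, ← IsScalarTower.algebraMap_apply, eq_neg_iff_add_eq_zero, ← hb, pow_succ,
        map_mul _ (π ^ n) π]
      ring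
    rw [h3, map_neg, h1, neg_zero]
  rw [AlgHom.commutes] at h2
  have h4 : algebraMap R (AddMonoidAlgebra R S) (π ^ n) * P ∈ semigroupIdeal π S ^ (n + 1) :=
    Ideal.Quotient.eq_zero_iff_mem.mp h2
  rw [Ideal.span_singleton_pow, Ideal.mem_span_singleton, ← map_pow] at h4
  obtain ⟨Q, hQ⟩ := h4
  rw [← Algebra.smul_def, ← Algebra.smul_def, pow_succ, mul_smul] at hQ
  have hPQ : P = π • Q := by
    ext u
    have := congrArg (fun z => z.coeff u) hQ
    simp only [AddMonoidAlgebra.coeff_smul, Finsupp.smul_apply, smul_eq_mul] at this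
    simpa using mul_left_cancel₀ (pow_ne_zero n hπ0) this
  rw [hPQ, map_smul, Algebra.smul_def, algebraMap_semigroupAlgebra_eq_zero hπ, zero_mul]

/-- A nonzero element of the completion is a multiple of an element with nonzero reduction. -/
theorem exists_eq_mul_of_ne_zero (hπ0 : π ≠ 0) (b : SemigroupCompletion π S) (hb : b ≠ 0) :
    ∃ (c : R) (P : AddMonoidAlgebra R S) (c' : R) (b' : SemigroupCompletion π S), c ≠ 0 ∧
      c' ∈ maximalIdeal R ∧ semigroupReduction P ≠ 0 ∧
      b = algebraMap R _ c * (algebraMap _ _ P + algebraMap R _ c' * b') := by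
  -- The completion is separated, so there is a largest `m` with `π ^ m ∣ b`.
  have h1 : ∃ n, ¬ algebraMap R (SemigroupCompletion π S) (π ^ n) ∣ b := by
    by_contra! h
    apply hb
    refine AdicCompletion.ext_evalₐ fun n => ?_
    obtain ⟨z, rfl⟩ := h n
    rw [evalₐ_pow_mul_eq_zero, map_zero]
  classical
  obtain ⟨m, hm⟩ : ∃ m, Nat.find h1 = m + 1 := by
    refine Nat.exists_eq_succ_of_ne_zero fun h => ?_
    have := Nat.find_spec h1
    rw [h] at this
    simp at this
  have h2 : algebraMap R (SemigroupCompletion π S) (π ^ m) ∣ b := by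
    by_contra h
    have := Nat.find_min' h1 h
    omega
  have h3 : ¬ algebraMap R (SemigroupCompletion π S) (π ^ (m + 1)) ∣ b := hm ▸ Nat.find_spec h1
  obtain ⟨g, rfl⟩ := h2
  have h4 : ¬ algebraMap R (SemigroupCompletion π S) π ∣ g := by
    intro h
    apply h3
    rw [pow_succ, map_mul]
    exact mul_dvd_mul_left _ h
  obtain ⟨P, b', rfl⟩ := exists_eq_algebraMap_add g
  have hP : P ≠ 0 := by
    rintro rfl
    exact h4 ⟨b', by simp⟩
  obtain ⟨d, G, hd, rfl, hG⟩ := exists_smul_map_residue_ne_zero P hP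
  have hsm : algebraMap (AddMonoidAlgebra R S) (SemigroupCompletion π S) (d • G) =
      algebraMap R _ d * algebraMap _ _ G := by
    rw [Algebra.smul_def, map_mul, ← IsScalarTower.algebraMap_apply]
  -- The content `d` of `P` is not a multiple of `π`, so `π = d * c'` with `c' ∈ 𝔪`, and `d` factors
  -- out of `P + π b'`.
  have hπd : ¬ π ∣ d := by
    intro h
    apply h4
    rw [hsm]
    exact dvd_add (dvd_mul_of_dvd_left ((algebraMap _ _).map_dvd h) _) (dvd_mul_right _ _)
  obtain ⟨c', hc'⟩ := (ValuationRing.dvd_total d π).resolve_right hπd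
  have hc'm : c' ∈ maximalIdeal R := by
    by_contra h
    have hu : IsUnit c' := by simpa using h
    exact hπd (hu.dvd_mul_right.mp hc'.dvd)
  refine ⟨π ^ m * d, G, c', b', mul_ne_zero (pow_ne_zero _ hπ0) hd, hc'm, hG, ?_⟩
  rw [hsm, map_mul, mul_assoc]
  congr 1
  have h5 : algebraMap R (SemigroupCompletion π S) π = algebraMap R _ d * algebraMap R _ c' := by
    rw [← map_mul, ← hc']
  rw [h5]
  ring

end Valuation

/-! ### Gordan's lemma and absence of zero divisors -/

section Gordan

open ToricAffinoid

variable {N : Type*} [AddCommGroup N]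

theorem mem_dualSemigroup_hull_iff (s : Finset N) (u : Module.Dual ℤ N) :
    u ∈ dualSemigroup (PointedCone.hull ℝ ((fun v : N => (1 : ℝ) ⊗ₜ[ℤ] v) '' (s : Set N))) ↔
      ∀ v ∈ s, 0 ≤ u v := by
  change Module.Dual.baseChange ℝ u ∈ dualCone _ ↔ _
  rw [dualCone, PointedCone.dual_hull, PointedCone.mem_dual]
  simp

/-- **Gordan's lemma** for the semigroup of a rational polyhedral cone. -/
theorem fg_dualSemigroup [Module.Free ℤ N] [Module.Finite ℤ N]
    {σ : PointedCone ℝ (RealSpace N)} (hσ : IsRationalPolyhedral σ) :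
    AddMonoid.FG (dualSemigroup σ) := by
  obtain ⟨s, rfl⟩ := hσ
  rw [AddMonoid.fg_iff_addSubmonoid_fg]
  let ι := Module.Free.ChooseBasisIndex ℤ (Module.Dual ℤ N)
  let β : Module.Basis ι ℤ (Module.Dual ℤ N) := Module.Free.chooseBasis ℤ (Module.Dual ℤ N)
  -- The unknowns are two natural numbers for each coordinate of `u`, which is their difference, and
  -- a slack for each `v ∈ s`. The equations `u v = slack` define a finitely generated submonoid of
  -- `X`, and the semigroup is its image under `h`.
  let X := (ι ⊕ ι) ⊕ s → ℕ
  let h : X →+ Module.Dual ℤ N :=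
    { toFun := fun x => ∑ i, ((x (.inl (.inl i)) : ℤ) - x (.inl (.inr i))) • β i
      map_zero' := by simp
      map_add' := fun x y => by
        rw [← Finset.sum_add_distrib]
        refine Finset.sum_congr rfl fun i _ => ?_
        rw [← add_smul]
        congr 1
        change ((x _ + y _ : ℕ) : ℤ) - (x _ + y _ : ℕ) = _
        push_cast
        ring }
  let f : X →+ (s → ℤ) :=
    { toFun := fun x v => h x v
      map_zero' := by ext; simp
      map_add' := fun x y => by ext; simp }
  let g : X →+ (s → ℤ) :=
    { toFun := fun x v => (x (.inr v) : ℤ)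
      map_zero' := rfl
      map_add' := fun x y => by ext v; exact Nat.cast_add (x (.inr v)) (y (.inr v)) }
  convert (AddSubmonoid.fg_eqLocusM f g).map h
  ext u
  rw [mem_dualSemigroup_hull_iff]
  constructor
  · intro hu
    let x : X := Sum.elim (Sum.elim (fun i => (β.repr u i).toNat) fun i => (-β.repr u i).toNat)
      fun v => (u v).toNat
    have hx : h x = u := by
      conv_rhs => rw [← β.sum_repr u]
      refine Finset.sum_congr rfl fun i _ => ?_
      congr 1
      exact Int.toNat_sub_toNat_neg _
    refine ⟨x, funext fun v => ?_, hx⟩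
    change h x v = ((u v).toNat : ℤ)
    rw [hx, Int.toNat_of_nonneg (hu v v.2)]
  · rintro ⟨x, hx, rfl⟩ v hv
    have : h x v = x (.inr ⟨v, hv⟩) := congrFun hx ⟨v, hv⟩
    rw [this]
    exact Int.natCast_nonneg _

/-- The semigroup embeds in a lattice, where products have a term arising from only one pair of
exponents; its coefficient cannot cancel. -/
theorem noZeroDivisors_dualSemigroup [Module.Free ℤ N] [Module.Finite ℤ N]
    (σ : PointedCone ℝ (RealSpace N)) (k : Type*) [Field k] :
    NoZeroDivisors (AddMonoidAlgebra k (dualSemigroup σ)) := by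
  let ι := Module.Free.ChooseBasisIndex ℤ (Module.Dual ℤ N)
  let β : Module.Basis ι ℤ (Module.Dual ℤ N) := Module.Free.chooseBasis ℤ (Module.Dual ℤ N)
  let j : dualSemigroup σ →+ (ι →₀ ℤ) :=
    (β.repr : Module.Dual ℤ N →+ (ι →₀ ℤ)).comp (dualSemigroup σ).subtype
  have hj : Function.Injective j := β.repr.injective.comp Subtype.val_injective
  have : TwoUniqueSums (dualSemigroup σ) := .of_injective_addHom j.toAddHom hj inferInstance
  infer_instance

end Gordan

/-! ### Norm and divisibility in the ring of integers -/

section Integers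

open ToricAffinoid

variable {K : Type*} [NontriviallyNormedField K] [IsUltrametricDist K]

theorem norm_le_one (c : Integers K) : ‖(c : K)‖ ≤ 1 := c.2

theorem dvd_iff_norm_le (a b : Integers K) (ha : a ≠ 0) : a ∣ b ↔ ‖(b : K)‖ ≤ ‖(a : K)‖ := by
  have ha' : (a : K) ≠ 0 := fun h => ha (Subtype.ext h)
  constructor
  · rintro ⟨c, rfl⟩
    simpa using mul_le_mul_of_nonneg_left (norm_le_one c) (norm_nonneg (a : K))
  · intro h
    have h1 : (b : K) / a ∈ Integers K := by
      change ‖(b : K) / a‖ ≤ 1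
      rw [norm_div]
      exact div_le_one_of_le₀ h (norm_nonneg _)
    refine ⟨⟨_, h1⟩, Subtype.ext ?_⟩
    change (b : K) = a * (b / a)
    field_simp

theorem mem_maximalIdeal_iff_norm (c : Integers K) :
    c ∈ IsLocalRing.maximalIdeal (Integers K) ↔ ‖(c : K)‖ < 1 :=
  Valuation.mem_maximalIdeal_iff _ _

theorem isPseudoUniformizer [CompleteSpace K] (π : Integers K) (hπ₀ : π ≠ 0)
    (hπ₁ : ‖(π : K)‖ < 1) : IsPseudoUniformizer π where
  ne_zero := hπ₀
  mem := (mem_maximalIdeal_iff_norm π).mpr hπ₁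
  dvd_pow c hc := by
    have hπ' : 0 < ‖(π : K)‖ := norm_pos_iff.mpr fun h => hπ₀ (Subtype.ext h)
    obtain ⟨n, hn⟩ := exists_pow_lt_of_lt_one hπ' ((mem_maximalIdeal_iff_norm c).mp hc)
    exact ⟨n, (dvd_iff_norm_le _ _ hπ₀).mpr (by simpa using hn.le)⟩
  dvd_pow_self c hc := by
    have hc' : 0 < ‖(c : K)‖ := norm_pos_iff.mpr fun h => hc (Subtype.ext h)
    obtain ⟨n, hn⟩ := exists_pow_lt_of_lt_one hc' hπ₁
    exact ⟨n, (dvd_iff_norm_le _ _ hc).mpr (by simpa using hn.le)⟩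
  isPrecomplete := by
    refine ⟨fun f hf => ?_⟩
    have key : ∀ (n : ℕ) (a b : Integers K),
        a ≡ b [SMOD (Ideal.span {π} ^ n • ⊤ : Ideal (Integers K))] ↔
          ‖(a : K) - b‖ ≤ ‖(π : K)‖ ^ n := by
      intro n a b
      rw [SModEq.sub_mem, smul_eq_mul, Ideal.mul_top, Ideal.span_singleton_pow,
        Ideal.mem_span_singleton, dvd_iff_norm_le _ _ (pow_ne_zero n hπ₀)]
      simp
    have hcau : CauchySeq fun n => (f n : K) := by
      refine cauchySeq_of_le_geometric ‖(π : K)‖ 1 hπ₁ fun n => ?_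
      rw [dist_eq_norm, one_mul]
      exact (key _ _ _).mp (hf n.le_succ)
    obtain ⟨l, hl⟩ := cauchySeq_tendsto_of_complete hcau
    have hl1 : ‖l‖ ≤ 1 := le_of_tendsto hl.norm (.of_forall fun n => norm_le_one (f n))
    refine ⟨⟨l, hl1⟩, fun n => (key _ _ _).mpr ?_⟩
    refine le_of_tendsto (tendsto_const_nhds.sub hl).norm ?_
    filter_upwards [Filter.eventually_ge_atTop n] with m hm
    exact (key _ _ _).mp (hf hm)

/-- `R` is integrally closed, so the minimal polynomial of `y` over `K` has coefficients in `R`. -/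
theorem spectralNorm_le_one {L : Type*} [Field L] [Algebra K L] [Algebra (Integers K) L]
    [IsScalarTower (Integers K) K L] (y : L) (hy : IsIntegral (Integers K) y) :
    spectralNorm K L y ≤ 1 := by
  have h1 := minpoly.isIntegrallyClosed_eq_field_fractions' K hy
  rw [spectralNorm, spectralValue_le_one_iff (minpoly.monic hy.tower_top), h1]
  intro n
  rw [Polynomial.coeff_map]
  exact norm_le_one _

end Integers

/-! ### Seminorm axioms from algebraic residue fields -/

section SupNorm

open ToricAffinoid

variable {K : Type*} [NontriviallyNormedField K] [IsUltrametricDist K] [CompleteSpace K]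
  {A : Type*} [CommRing A] [Algebra K A]

theorem valueAt_mul (x : MaximalSpectrum A) [h : Algebra.IsAlgebraic K (A ⧸ x.asIdeal)]
    (f g : A) : valueAt K x (f * g) = valueAt K x f * valueAt K x g := by
  let := Ideal.Quotient.field x.asIdeal
  have : Algebra.IsAlgebraic K (A ⧸ x.asIdeal) := h
  rw [valueAt, map_mul]
  exact spectralAlgNorm_mul _ _

omit [CompleteSpace K] in
theorem valueAt_add_le (x : MaximalSpectrum A) [h : Algebra.IsAlgebraic K (A ⧸ x.asIdeal)]
    (f g : A) : valueAt K x (f + g) ≤ max (valueAt K x f) (valueAt K x g) := by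
  let := Ideal.Quotient.field x.asIdeal
  have : Algebra.IsAlgebraic K (A ⧸ x.asIdeal) := h
  rw [valueAt, map_add]
  exact isNonarchimedean_spectralNorm _ _

omit [IsUltrametricDist K] [CompleteSpace K] in
theorem valueAt_algebraMap (x : MaximalSpectrum A) (c : K) :
    valueAt K x (algebraMap K A c) = ‖c‖ := by
  let := Ideal.Quotient.field x.asIdeal
  exact spectralNorm_extends c

omit [IsUltrametricDist K] [CompleteSpace K] in
theorem valueAt_nonneg (x : MaximalSpectrum A) (f : A) : 0 ≤ valueAt K x f := by
  let := Ideal.Quotient.field x.asIdeal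
  exact spectralNorm_nonneg _

omit [IsUltrametricDist K] [CompleteSpace K] in
theorem valueAt_le_supNorm (x : MaximalSpectrum A) (f : A) :
    ENNReal.ofReal (valueAt K x f) ≤ supNorm K f :=
  le_iSup (fun x => ENNReal.ofReal (valueAt K x f)) x

theorem isSupSeminorm_of_isAlgebraic
    (h : ∀ x : MaximalSpectrum A, Algebra.IsAlgebraic K (A ⧸ x.asIdeal)) : IsSupSeminorm K A where
  add_le_max f g := iSup_le fun x => by
    have := h x
    refine (ENNReal.ofReal_le_ofReal (valueAt_add_le x f g)).trans ?_
    rw [ENNReal.ofReal_max]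
    exact max_le_max (valueAt_le_supNorm x f) (valueAt_le_supNorm x g)
  mul_le f g := iSup_le fun x => by
    have := h x
    rw [valueAt_mul, ENNReal.ofReal_mul (valueAt_nonneg x f)]
    exact mul_le_mul' (valueAt_le_supNorm x f) (valueAt_le_supNorm x g)
  algebraMap_le c := iSup_le fun x => by rw [valueAt_algebraMap]

end SupNorm

/-! ### Supremum norm equals Gauss norm -/

section SupNormCompletion

open ToricAffinoid

variable {K : Type*} [NontriviallyNormedField K] [IsUltrametricDist K] [CompleteSpace K]
  {A : Type*} [CommRing A] [Algebra K A] {π : Integers K} {S : Type*} [AddCommMonoid S]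

omit [IsUltrametricDist K] [CompleteSpace K] in
theorem reduction_mk_surjective (h : IsSupSeminorm K A) : Function.Surjective (Reduction.mk h) :=
  Ideal.Quotient.mk_surjective

omit [IsUltrametricDist K] [CompleteSpace K] in
theorem reduction_mk_eq_zero_iff (h : IsSupSeminorm K A) (f : unitBall h) :
    Reduction.mk h f = 0 ↔ supNorm K (f : A) < 1 :=
  Ideal.Quotient.eq_zero_iff_mem

omit [IsUltrametricDist K] [CompleteSpace K] in
theorem supNorm_smul_le (h : IsSupSeminorm K A) (c : K) (f : A) :
    supNorm K (c • f) ≤ ENNReal.ofReal ‖c‖ * supNorm K f := by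
  rw [Algebra.smul_def]
  exact (h.mul_le _ _).trans (mul_le_mul_left (h.algebraMap_le c) _)

variable (π S) in
/-- The algebra `K⟨S⟩`. -/
noncomputable abbrev RationalCompletion : Type _ := K ⊗[Integers K] SemigroupCompletion π S

omit [CompleteSpace K] in
theorem one_tmul_algebraMap_mul (c : Integers K) (b : SemigroupCompletion π S) :
    (1 ⊗ₜ (algebraMap _ _ c * b) : RationalCompletion π S) = (c : K) • 1 ⊗ₜ b := by
  rw [← Algebra.smul_def, TensorProduct.tmul_smul]
  rfl

/-- The map from `R[S]` to `K⟨S⟩`. -/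
noncomputable def toRationalCompletion :
    AddMonoidAlgebra (Integers K) S →+* RationalCompletion π S :=
  (Algebra.TensorProduct.includeRight :
    SemigroupCompletion π S →ₐ[Integers K] RationalCompletion π S).toRingHom.comp (algebraMap _ _)

omit [CompleteSpace K] in
theorem toRationalCompletion_algebraMap (c : Integers K) :
    toRationalCompletion (π := π) (S := S) (algebraMap _ _ c) = (c : K) • 1 := by
  change (1 ⊗ₜ algebraMap _ _ (algebraMap _ _ c) : RationalCompletion π S) = _
  rw [← IsScalarTower.algebraMap_apply, ← mul_one (algebraMap _ _ c), one_tmul_algebraMap_mul,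
    ← Algebra.TensorProduct.one_def]

variable [AddMonoid.FG S]

theorem isSupSeminorm_semigroupCompletion (hπ : IsPseudoUniformizer π) : IsSupSeminorm K (RationalCompletion π S) :=
  isSupSeminorm_of_isAlgebraic fun x =>
    (isTopologicallyFiniteType_semigroupCompletion hπ).isAlgebraic_quotient K hπ x.asIdeal

omit [CompleteSpace K] in
theorem supNorm_tmul_le_one (hπ : IsPseudoUniformizer π) (b : SemigroupCompletion π S) :
    supNorm K (1 ⊗ₜ b : RationalCompletion π S) ≤ 1 := by
  refine iSup_le fun x => ENNReal.ofReal_le_one.mpr ?_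
  let := Ideal.Quotient.field x.asIdeal
  exact spectralNorm_le_one _
    ((isTopologicallyFiniteType_semigroupCompletion hπ).isIntegral_tmul K hπ x.asIdeal b)

/-- At a point where the inverse of `P` is integral, that inverse has value at most 1, and values
multiply. -/
theorem one_le_supNorm_tmul (hπ : IsPseudoUniformizer π)
    [NoZeroDivisors (AddMonoidAlgebra (IsLocalRing.ResidueField (Integers K)) S)]
    (P : AddMonoidAlgebra (Integers K) S) (hP : semigroupReduction P ≠ 0) :
    1 ≤ supNorm K (1 ⊗ₜ algebraMap _ _ P : RationalCompletion π S) := by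
  obtain ⟨x, z, hz, hxz⟩ :=
    (isTopologicallyFiniteType_semigroupCompletion hπ).exists_maximal_isIntegral_inv K hπ
    (completionReduction hπ.mem) (fun c hc => algebraMap_semigroupAlgebra_eq_zero hc)
    (exists_dvd_of_completionReduction_eq_zero hπ.mem)
    (completionReduction_eq_zero_of_torsion hπ.ne_zero hπ.mem)
    (algebraMap _ (SemigroupCompletion π S) P)
    (by rwa [completionReduction_algebraMap, isNilpotent_iff_eq_zero])
  refine le_trans ?_ (valueAt_le_supNorm x _)
  rw [ENNReal.one_le_ofReal]
  have halg := (isTopologicallyFiniteType_semigroupCompletion (S := S) hπ).isAlgebraic_quotient K hπ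
    x.asIdeal
  obtain ⟨f, rfl⟩ := Ideal.Quotient.mk_surjective z
  have h1 : valueAt K x f ≤ 1 := by
    let := Ideal.Quotient.field x.asIdeal
    exact spectralNorm_le_one _ hz
  have h2 : valueAt K x (1 ⊗ₜ algebraMap _ _ P) * valueAt K x f = 1 := by
    rw [← valueAt_mul]
    unfold valueAt
    rw [map_mul, hxz]
    let := Ideal.Quotient.field x.asIdeal
    exact spectralNorm_one
  have h3 := valueAt_nonneg (K := K) x f
  have h4 := valueAt_nonneg (K := K) x (1 ⊗ₜ algebraMap _ _ P)
  nlinarith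

theorem supNorm_tmul_mul_lt_one (hπ : IsPseudoUniformizer π) {c : Integers K}
    (hc : c ∈ IsLocalRing.maximalIdeal (Integers K)) (b : SemigroupCompletion π S) :
    supNorm K (1 ⊗ₜ (algebraMap _ _ c * b) : RationalCompletion π S) < 1 := by
  have h := isSupSeminorm_semigroupCompletion (S := S) hπ
  rw [one_tmul_algebraMap_mul]
  calc _ ≤ ENNReal.ofReal ‖(c : K)‖ * 1 := (supNorm_smul_le h _ _).trans
        (mul_le_mul_right (supNorm_tmul_le_one hπ b) _)
    _ < 1 := by
        rw [mul_one, ENNReal.ofReal_lt_one]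
        exact (mem_maximalIdeal_iff_norm c).mp hc

/-- For `f ≠ 0`, write `f = k • g` with `g = P + c' b'` primitive. As `|g| ≥ 1`, the bound on `f`
forces `‖k‖ ≤ 1`, and `k • P` approximates `f` with error `k c' b'`. -/
theorem exists_supNorm_sub_lt_one (hπ : IsPseudoUniformizer π)
    [NoZeroDivisors (AddMonoidAlgebra (IsLocalRing.ResidueField (Integers K)) S)]
    (f : RationalCompletion π S) (hf : supNorm K f ≤ 1) :
    ∃ P : AddMonoidAlgebra (Integers K) S, supNorm K (f - 1 ⊗ₜ algebraMap _ _ P) < 1 := by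
  have h := isSupSeminorm_semigroupCompletion (S := S) hπ
  obtain ⟨n, b, hb⟩ := exists_pow_mul_eq_tmul K hπ f
  have hπn : ((π : K) ^ n) ≠ 0 := pow_ne_zero n fun h => hπ.ne_zero (Subtype.ext h)
  have hf1 : f = ((π : K) ^ n)⁻¹ • 1 ⊗ₜ b := by
    rw [← hb, ← algebraMap_smul K (π ^ n) f, smul_smul]
    have : algebraMap (Integers K) K (π ^ n) = (π : K) ^ n := rfl
    rw [this, inv_mul_cancel₀ hπn, one_smul]
  by_cases hb0 : b = 0
  · refine ⟨0, ?_⟩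
    rw [hf1, hb0, map_zero, TensorProduct.tmul_zero, smul_zero, sub_zero]
    simpa using (supNorm_smul_le h 0 0).trans_lt (by simp)
  obtain ⟨c, P, c', b', hc, hc', hP, rfl⟩ := exists_eq_mul_of_ne_zero hπ.ne_zero b hb0
  set g : SemigroupCompletion π S := algebraMap _ _ P + algebraMap _ _ c' * b' with hg
  have hc0 : (c : K) ≠ 0 := fun h => hc (Subtype.ext h)
  let k : K := ((π : K) ^ n)⁻¹ * c
  have hk0 : k ≠ 0 := mul_ne_zero (inv_ne_zero hπn) hc0
  have hf2 : f = k • 1 ⊗ₜ g := by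
    rw [hf1, one_tmul_algebraMap_mul, smul_smul]
  have hPg : (1 ⊗ₜ algebraMap _ _ P : RationalCompletion π S) = 1 ⊗ₜ g + -(1 ⊗ₜ (algebraMap _ _ c' * b')) := by
    rw [hg, TensorProduct.tmul_add, add_neg_cancel_right]
  have hg1 : 1 ≤ supNorm K (1 ⊗ₜ g : RationalCompletion π S) := by
    by_contra! hlt
    refine (one_le_supNorm_tmul hπ P hP).not_gt ?_
    rw [hPg]
    exact (h.add_le_max _ _).trans_lt (max_lt hlt
      ((h.neg_le _).trans_lt (supNorm_tmul_mul_lt_one hπ hc' b')))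
  have hk : ‖k‖ ≤ 1 := by
    have h1 : (1 ⊗ₜ g : RationalCompletion π S) = k⁻¹ • f := by
      rw [hf2, smul_smul, inv_mul_cancel₀ hk0, one_smul]
    have h2 : 1 ≤ ENNReal.ofReal ‖k⁻¹‖ := by
      refine hg1.trans (h1 ▸ (supNorm_smul_le h k⁻¹ f).trans ?_)
      exact (mul_le_mul_right hf _).trans (mul_one _).le
    rw [ENNReal.one_le_ofReal, norm_inv, one_le_inv₀ (norm_pos_iff.mpr hk0)] at h2
    exact h2
  let d : Integers K := ⟨k, hk⟩
  refine ⟨d • P, ?_⟩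
  have h5 : f - 1 ⊗ₜ algebraMap _ _ (d • P) = 1 ⊗ₜ (algebraMap _ _ c' * (algebraMap _ _ d * b')) := by
    have h6 : f = 1 ⊗ₜ (algebraMap _ _ d * g) := hf2.trans (one_tmul_algebraMap_mul d g).symm
    rw [h6, ← TensorProduct.tmul_sub, Algebra.smul_def, map_mul,
      ← IsScalarTower.algebraMap_apply, hg]
    congr 1
    ring
  rw [h5]
  exact supNorm_tmul_mul_lt_one hπ hc' _

variable (π S) in
/-- The map from `R[S]` to `K⟨S⟩`. -/
noncomputable def toToricAlgebra : AddMonoidAlgebra (Integers K) S →+* ToricAlgebra π S :=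
  toRationalCompletion

theorem exists_supNorm_sub_toToricAlgebra_lt_one (hπ : IsPseudoUniformizer π)
    [NoZeroDivisors (AddMonoidAlgebra (IsLocalRing.ResidueField (Integers K)) S)]
    (f : ToricAlgebra π S) (hf : supNorm K f ≤ 1) :
    ∃ P : AddMonoidAlgebra (Integers K) S, supNorm K (f - toToricAlgebra π S P) < 1 := by
  let g : RationalCompletion π S := f
  obtain ⟨P, hP⟩ := exists_supNorm_sub_lt_one hπ g hf
  refine ⟨P, ?_⟩
  have h1 : f - toToricAlgebra π S P = (g - 1 ⊗ₜ algebraMap _ _ P : RationalCompletion π S) := rfl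
  rw [h1]
  exact hP

end SupNormCompletion

/-! ### Identification of the reduction with `k[S]` -/

section Reduction

open ToricAffinoid

variable {K : Type*} [NontriviallyNormedField K] [IsUltrametricDist K] {A : Type*} [CommRing A]
  [Algebra K A] {S : Type*} [AddCommMonoid S]

/-- If `R[S]` is dense in the unit ball of the supremum norm, and the supremum norm restricts to
the Gauss norm on `R[S]`, then the reduction is `k[S]`. -/
theorem exists_reduction_algEquiv (h : IsSupSeminorm K A)
    (i : AddMonoidAlgebra (Integers K) S →+* A)
    (hi : ∀ c : Integers K, i (algebraMap _ _ c) = (c : K) • 1)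
    (hle : ∀ P, supNorm K (i P) ≤ 1)
    (hge : ∀ P, semigroupReduction P ≠ 0 → 1 ≤ supNorm K (i P))
    (hdense : ∀ f, supNorm K f ≤ 1 → ∃ P, supNorm K (f - i P) < 1) :
    ∃ e : Reduction h ≃ₐ[ToricAffinoid.ResidueField K]
        AddMonoidAlgebra (ToricAffinoid.ResidueField K) S,
      ∀ u : S, ∃ hu : i (AddMonoidAlgebra.single u 1) ∈ unitBall h,
        e (Reduction.mk h ⟨i (AddMonoidAlgebra.single u 1), hu⟩) =
          AddMonoidAlgebra.single u 1 := by
  let Φ : AddMonoidAlgebra (Integers K) S →+* Reduction h :=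
    (Reduction.mk h).comp (i.codRestrict (unitBall h) hle)
  -- The inverse isomorphism is built first, since a map out of `k[S]` is determined by the
  -- monomials. Its injectivity is `hge`, its surjectivity `hdense`.
  let θ : AddMonoidAlgebra (ToricAffinoid.ResidueField K) S →ₐ[ToricAffinoid.ResidueField K]
      Reduction h := AddMonoidAlgebra.lift _ _ _
        { toFun := fun u => Φ (AddMonoidAlgebra.single u.toAdd 1)
          map_one' := map_one Φ
          map_mul' := fun u v => by
            rw [← map_mul, AddMonoidAlgebra.single_mul_single, mul_one]
            rfl }
  have hθ1 : ∀ u : S, θ (AddMonoidAlgebra.single u 1) = Φ (AddMonoidAlgebra.single u 1) := by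
    intro u
    simp only [θ, AddMonoidAlgebra.lift_single, one_smul]
    rfl
  have hθ : ∀ P, θ (semigroupReduction P) = Φ P := by
    have : (RingHomClass.toRingHom θ).comp
        (RingHomClass.toRingHom (semigroupReduction (R := Integers K) (S := S))) = Φ := by
      refine AddMonoidAlgebra.ringHom_ext (fun r => ?_) fun u => ?_
      · change θ (semigroupReduction (algebraMap _ _ r)) = Φ (algebraMap _ _ r)
        rw [AlgHom.commutes, IsScalarTower.algebraMap_apply (Integers K)
          (ToricAffinoid.ResidueField K), AlgHom.commutes]
        refine congrArg (Reduction.mk h) (Subtype.ext ?_)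
        exact (Algebra.algebraMap_eq_smul_one _).trans (hi r).symm
      · change θ (semigroupReduction (AddMonoidAlgebra.single u 1)) = _
        rw [← hθ1]
        simp [semigroupReduction]
    exact fun P => RingHom.congr_fun this P
  have hred : Function.Surjective
      (semigroupReduction (R := Integers K) (S := S)) :=
    AddMonoidAlgebra.map_surjective _ IsLocalRing.residue_surjective
  have hbij : Function.Bijective θ := by
    constructor
    · rw [injective_iff_map_eq_zero]
      intro a ha
      obtain ⟨P, rfl⟩ := hred a
      by_contra hP
      rw [hθ] at ha
      exact (hge P hP).not_gt ((reduction_mk_eq_zero_iff h ⟨i P, hle P⟩).mp ha)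
    · intro z
      obtain ⟨f, rfl⟩ := reduction_mk_surjective h z
      obtain ⟨P, hP⟩ := hdense f f.2
      refine ⟨semigroupReduction P, ?_⟩
      rw [hθ, eq_comm, ← sub_eq_zero]
      change Reduction.mk h f - Reduction.mk h ⟨i P, hle P⟩ = 0
      rw [← map_sub, reduction_mk_eq_zero_iff]
      exact hP
  refine ⟨(AlgEquiv.ofBijective θ hbij).symm, fun u => ⟨hle _, ?_⟩⟩
  rw [AlgEquiv.symm_apply_eq]
  exact (hθ1 u).symm

end Reduction

end ToricReduction

open ToricAffinoid in
theorem mainTheorem6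
    {K : Type*} [NontriviallyNormedField K] [IsUltrametricDist K] [CompleteSpace K]
    (π : Integers K) (hπ₀ : π ≠ 0) (hπ₁ : ‖(π : K)‖ < 1)
    {N : Type*} [AddCommGroup N] [Module.Free ℤ N] [Module.Finite ℤ N]
    (σ : PointedCone ℝ (RealSpace N))
    (hσ : IsRationalPolyhedral σ) (hσ' : IsStronglyConvex σ) :
    ∃ h : IsSupSeminorm K (ToricAlgebra π (dualSemigroup σ)),
      ∃ e : Reduction h ≃ₐ[ResidueField K]
          AddMonoidAlgebra (ResidueField K) (dualSemigroup σ),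
        ∀ u : dualSemigroup σ, ∃ hu : monomial π u ∈ unitBall h,
          e (Reduction.mk h ⟨monomial π u, hu⟩) = AddMonoidAlgebra.single u 1 := by
  have hπ := ToricReduction.isPseudoUniformizer π hπ₀ hπ₁
  have := ToricReduction.fg_dualSemigroup hσ
  have := ToricReduction.noZeroDivisors_dualSemigroup σ (ResidueField K)
  -- `ToricAlgebra` unfolds to `RationalCompletion`, so results on the latter apply by definitional
  -- equality.
  have h : IsSupSeminorm K (ToricAlgebra π (dualSemigroup σ)) :=
    ToricReduction.isSupSeminorm_semigroupCompletion hπ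
  exact ⟨h, ToricReduction.exists_reduction_algEquiv h
    (ToricReduction.toToricAlgebra π (dualSemigroup σ))
    ToricReduction.toRationalCompletion_algebraMap
    (fun P => ToricReduction.supNorm_tmul_le_one hπ _)
    (ToricReduction.one_le_supNorm_tmul hπ)
    (ToricReduction.exists_supNorm_sub_toToricAlgebra_lt_one hπ)⟩
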